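/- Let $K$ be a non-archimedean local field (for instance one of positive characteristic), with ring of integers $\mathcal O=\{x:|x|\le 1\}$, prime ideal $\mathfrak P=\{x:|x|<1\}$, prime element $\mathfrak p$ (so $\mathfrak P=\mathfrak p\mathcal O$), residue field of cardinality $q$, and Haar measure $dx$ on $(K,+)$ normalized by $|\mathcal O|=1$; put $\mathfrak P^{-1}=\mathfrak p^{-1}\mathcal O$ and $\mathbb N_0=\{0,1,2,\dots\}$. Let $\chi$ be a continuous unitary character of $(K,+)$ which is trivial on $\mathcal O$ and nontrivial on $\mathfrak P^{-1}$, and let $\hat f$ be the extension by continuity to $L^2(K)$ of $\hat f(\xi)=\int_K f(x)\chi(-\xi x)\,dx$. Let $u(0)=0,u(1),\dots,u(q-1)$ be a complete set of distinct representatives of the cosets of $\mathcal O$ in $\mathfrak P^{-1}$ (so $|u(n)|=|\mathfrak p|^{-1}$ for $0<n<q$), and put $u(n)=\sum_{k} u(b_k)\mathfrak p^{-k}$ for $n=\sum_{k} b_kq^k\in\mathbb N_0$ with $0\le b_k<q$. On $L^2(K)$ let $D^jf(x)=q^{j/2}f(\mathfrak p^{-j}x)$ for $j\in\mathbb Z$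 and $T_kf(x)=f(x-u(k))$ for $k\in\mathbb N_0$. There exist $\psi_1,\dots,\psi_{q-1},\varphi\in L^2(K)$ with $\hat\psi_i=\mathbf 1_{\mathcal O+u(i)}$ for $1\le i\le q-1$ and $\hat\varphi=\mathbf 1_{\mathcal O}$, and for all such functions the following holds. 1. $\Psi=\{\psi_1,\dots,\psi_{q-1}\}$ is an orthonormal multiwavelet of order $q-1$ for $L^2(K)$, that is, the family $\{D^jT_k\psi_i: 1\le i\le q-1,\ j\in\mathbb Z,\ k\in\mathbb N_0\}$ is an orthonormal basis of $L^2(K)$. 2. $\Psi$ is associated with a multiresolution analysis whose scaling function is $\varphi$. That is, let $V$ be the closed linear span of $\{D^jT_k\psi_i: j<0,\ k\in\mathbb N_0,\ 1\le i\le q-1\}$. Then all $D^jV$ $(j\in\mathbb Z)$ are closed, $T_kV=V$ for all $k\in\mathbb N_0$, $V\subset D^1V$, $\bigcap_{j\in\mathbb Z} D^jV=\{0\}$, $\overline{\bigcup_{j\in\mathbb Z} D^jV}=L^2(K)$, $\varphi\in V$, and $\{T_k\varphi\}_{k\in\mathbb N_0}$ is an orthonormal basis of $V$. -/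

import Mathlib

open MeasureTheory Filter Topology

namespace LocalFieldWavelet

section Field

variable (K : Type*) [NontriviallyNormedField K] [IsUltrametricDist K]

/-- The cardinality `q` of the residue field of the ring of integers `𝒪 = {x : ‖x‖ ≤ 1}`. -/
noncomputable def residueCard : ℕ :=
  Nat.card (IsLocalRing.ResidueField (NormedField.valuation (K := K)).valuationSubring)

variable {K}

/-- `ϖ` is a prime element: an element of `𝔓 = {x : ‖x‖ < 1}` of maximal absolute value. -/
def IsPrimeElement (ϖ : Kˣ) : Prop :=
  ‖(ϖ : K)‖ < 1 ∧ ∀ x : K, ‖x‖ < 1 → ‖x‖ ≤ ‖(ϖ : K)‖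

/-- The translation sequence `u(0), u(1), …`: the elements `u(0), …, u(q - 1)` are a complete set
of distinct representatives of the cosets of `𝒪` in `𝔓⁻¹ = ϖ⁻¹ 𝒪 = {x : ‖x‖ ≤ ‖ϖ‖⁻¹}`, with
`u(0) = 0` and `‖u(n)‖ = ‖ϖ‖⁻¹` for `0 < n < q`, and
`u(n) = ∑ₖ u(bₖ) ϖ⁻ᵏ` when `n = ∑ₖ bₖ qᵏ` is the expansion of `n` in base `q`. -/
structure IsTranslationSequence (ϖ : Kˣ) (u : ℕ → K) : Prop where
  zero : u 0 = 0
  norm_eq : ∀ n, 0 < n → n < residueCard K → ‖u n‖ = ‖(ϖ : K)‖⁻¹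
  complete : ∀ x : K, ‖x‖ ≤ ‖(ϖ : K)‖⁻¹ → ∃! n : ℕ, n < residueCard K ∧ ‖x - u n‖ ≤ 1
  expansion : ∀ n, u n = ∑ k ∈ Finset.range (Nat.digits (residueCard K) n).length,
    u (n / residueCard K ^ k % residueCard K) * ((ϖ : K) ^ k)⁻¹

end Field

section Operators

variable {K : Type*} [NontriviallyNormedField K] [LocallyCompactSpace K]
  [MeasurableSpace K] [BorelSpace K] (μ : Measure K) [μ.IsAddHaarMeasure]

theorem exists_map_mul (a : Kˣ) :
    ∃ c : NNReal, Measure.map (fun x : K => (a : K) * x) μ = c • μ := by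
  have : ProperSpace K := ProperSpace.of_locallyCompactSpace K
  let e : K ≃+ K := DistribMulAction.toAddEquiv K a
  have he : (Measure.map e μ).IsAddHaarMeasure :=
    e.isAddHaarMeasure_map μ (continuous_const_smul a) (continuous_const_smul a⁻¹)
  exact ⟨_, Measure.isAddLeftInvariant_eq_smul (Measure.map e μ) μ⟩

theorem quasiMeasurePreserving_mul (a : Kˣ) :
    Measure.QuasiMeasurePreserving (fun x : K => (a : K) * x) μ μ := by
  obtain ⟨c, hc⟩ := exists_map_mul μ a
  refine ⟨(continuous_const.mul continuous_id).measurable, ?_⟩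
  rw [hc]
  exact Measure.smul_absolutelyContinuous

theorem memLp_comp_mul (a : Kˣ) (r : ℂ) (f : Lp ℂ 2 μ) :
    MemLp (fun x : K => r * f ((a : K) * x)) 2 μ := by
  obtain ⟨c, hc⟩ := exists_map_mul μ a
  refine MemLp.const_mul (f := fun x : K => f ((a : K) * x)) ?_ r
  refine MemLp.comp_of_map (f := fun x : K => (a : K) * x) (g := f) ?_
    (continuous_const.mul continuous_id).measurable.aemeasurable
  rw [hc]
  exact (Lp.memLp f).smul_measure ENNReal.coe_ne_top

variable [IsUltrametricDist K]

/-- The dilation operator `(D^j f)(x) = q^{j/2} f(ϖ⁻ʲ x)` on `L²(K)`. -/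
noncomputable def dilation (ϖ : Kˣ) (j : ℤ) : Lp ℂ 2 μ →ₗ[ℂ] Lp ℂ 2 μ where
  toFun f := (memLp_comp_mul μ (ϖ ^ (-j))
    (((residueCard K : ℝ) ^ ((j : ℝ) / 2) : ℝ) : ℂ) f).toLp
    (fun x : K => (((residueCard K : ℝ) ^ ((j : ℝ) / 2) : ℝ) : ℂ) *
      f (((ϖ ^ (-j) : Kˣ) : K) * x))
  map_add' f g := by
    rw [← MemLp.toLp_add]
    refine MemLp.toLp_congr _ _ ?_
    filter_upwards [(quasiMeasurePreserving_mul μ (ϖ ^ (-j))).ae (Lp.coeFn_add f g)] with x hx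
    simp only [Pi.add_apply] at hx ⊢
    rw [hx, mul_add]
  map_smul' r f := by
    rw [RingHom.id_apply, ← MemLp.toLp_const_smul]
    refine MemLp.toLp_congr _ _ ?_
    filter_upwards [(quasiMeasurePreserving_mul μ (ϖ ^ (-j))).ae (Lp.coeFn_smul r f)] with x hx
    simp only [Pi.smul_apply, smul_eq_mul] at hx ⊢
    rw [hx]
    ring

/-- The translation operator `(T_a f)(x) = f(x - a)` on `L²(K)`. -/
noncomputable def translation (a : K) : Lp ℂ 2 μ →ₗ[ℂ] Lp ℂ 2 μ :=
  Lp.compMeasurePreservingₗ ℂ (fun x : K => x - a) (measurePreserving_sub_right μ a)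

/-- `g` is the Fourier transform of `f ∈ L²(K)`: it is the value at `f` of the extension by
continuity to `L²(K)` of `f̂(ξ) = ∫ f(x) χ(-ξ x) dx`, `f ∈ L¹(K) ∩ L²(K)`. -/
def HasFourierTransform (χ : AddChar K Circle) (f : Lp ℂ 2 μ) (g : K → ℂ) : Prop :=
  MemLp g 2 μ ∧ ∃ F : ℕ → Lp ℂ 2 μ, (∀ n, Integrable (F n) μ) ∧ Tendsto F atTop (𝓝 f) ∧
    Tendsto (fun n => eLpNorm (Fourier.fourierIntegral χ μ (F n) - g) 2 μ) atTop (𝓝 0)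

variable {μ}

/-- The family `v` is an orthonormal basis of the closed subspace `V` of `L²(K)`. -/
def IsOrthonormalBasisOf {ι : Type*} (v : ι → Lp ℂ 2 μ) (V : Submodule ℂ (Lp ℂ 2 μ)) : Prop :=
  Orthonormal ℂ v ∧ (Submodule.span ℂ (Set.range v)).topologicalClosure = V

/-- `Ψ = {ψ₁, …, ψ_L}` is an orthonormal multiwavelet of order `L`: the affine system
`D^j T_k ψ_m`, with `1 ≤ m ≤ L`, `j ∈ ℤ`, `k ∈ ℕ₀`, is an orthonormal basis of `L²(K)`. -/
def IsOrthonormalMultiwavelet (ϖ : Kˣ) (u : ℕ → K) {L : ℕ} (Ψ : Fin L → Lp ℂ 2 μ) : Prop :=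
  IsOrthonormalBasisOf
    (fun i : Fin L × ℤ × ℕ => dilation μ ϖ i.2.1 (translation μ (u i.2.2) (Ψ i.1))) ⊤

/-- The space of negative dilates of `Ψ`: the closed span of the `D^j T_k ψ` with `j < 0`. -/
noncomputable def negativeDilates (ϖ : Kˣ) (u : ℕ → K) {L : ℕ} (Ψ : Fin L → Lp ℂ 2 μ) :
    Submodule ℂ (Lp ℂ 2 μ) :=
  (Submodule.span ℂ {f | ∃ (j : ℤ) (k : ℕ) (m : Fin L), j < 0 ∧
    f = dilation μ ϖ j (translation μ (u k) (Ψ m))}).topologicalClosure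

/-- `φ` is an orthonormal scaling function for `V`. -/
def IsOrthonormalScalingFunction (u : ℕ → K) (V : Submodule ℂ (Lp ℂ 2 μ))
    (φ : Lp ℂ 2 μ) : Prop :=
  φ ∈ V ∧ IsOrthonormalBasisOf (fun k : ℕ => translation μ (u k) φ) V

/-- The subspaces `D^j V`, `j ∈ ℤ`, form a multiresolution analysis of `L²(K)`. -/
structure IsMRA (ϖ : Kˣ) (u : ℕ → K) (V : Submodule ℂ (Lp ℂ 2 μ)) : Prop where
  isClosed : ∀ j : ℤ, IsClosed (V.map (dilation μ ϖ j) : Set (Lp ℂ 2 μ))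
  translation_invariant : ∀ k : ℕ, V.map (translation μ (u k)) = V
  le_dilation : V ≤ V.map (dilation μ ϖ 1)
  iInter_eq : ⋂ j : ℤ, (V.map (dilation μ ϖ j) : Set (Lp ℂ 2 μ)) = {0}
  closure_iUnion_eq : closure (⋃ j : ℤ, (V.map (dilation μ ϖ j) : Set (Lp ℂ 2 μ))) = Set.univ
  exists_scaling : ∃ φ, IsOrthonormalScalingFunction u V φ

end Operators

end LocalFieldWavelet

/-! Everything is explicit: on the space side `ψ_i` is `x ↦ χ(u(i)x)` on `𝒪`, extended by zero, and
`φ` is the indicator of `𝒪`. Orthogonality of characters on balls shows that these have the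
prescribed transforms (`hasFourierTransform_ballChar`). The multiplication formula `∫ f̂ h = ∫ f ĥ`,
tested on characters cut off to balls, shows that a transform determines the integrals of `f` over
all balls, hence `f` itself (`HasFourierTransform.unique`); Plancherel is not needed.

The map `n ↦ u(n) + 𝒪` is a bijection from `ℕ` onto `K/𝒪`, so the translates of `φ` are the
indicators of the cosets of `𝒪`. On `𝒪` the function `χ(u(i)x)` is constant on cosets of `𝔓`, so
`T_k ψ_i` is a combination of the `q` functions `D T_{m+qk} φ`, with the unitary matrix `q^{-1/2}
χ(ϖ u(i) u(m))` of coefficients. This is a filter bank (`isFilterBank_wavelet`), and the rest is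
Hilbert space geometry.

Orthonormality follows from the rows of the matrix and the nesting of the spaces `D^j V`.
Completeness is a contraction argument (`inner_scaling_eq_zero`): if `f` is orthogonal to the
wavelets at all levels below `J`, passing from one level to the next coarser one multiplies its
scaling coefficients by numbers of modulus `q^{-1/2} < 1`, and these coefficients are bounded by
`‖f‖`, so they vanish. A function orthogonal to every `D^j T_n φ` has zero integral over every ball,
hence is zero. -/

namespace LocalFieldWavelet

/-! ### Filter banks in an abstract Hilbert space. -/

section Hilbert

open Finset ComplexConjugate

variable {H : Type*} [NormedAddCommGroup H] [InnerProductSpace ℂ H]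

/-- An orthonormal sequence `e`, playing the role of the translates of a scaling function,
together with the unitary filter bank `c` which produces from the dilates of `e` the sequences
`w i`, playing the role of the translates of the wavelets for `0 < i < q`, and `w 0 = e`. -/
structure IsFilterBank (U : H ≃ₗᵢ[ℂ] H) (q : ℕ) (e : ℕ → H) (w : ℕ → ℕ → H)
    (c : ℕ → ℕ → ℂ) : Prop where
  pos : 0 < q
  orthonormal : Orthonormal ℂ e
  zero : ∀ k, w 0 k = e k
  expansion : ∀ i < q, ∀ k, w i k = ∑ m ∈ range q, c i m • U (e (m + q * k))
  row : ∀ i < q, ∀ j < q, ∑ m ∈ range q, conj (c i m) * c j m = if i = j then 1 else 0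
  col : ∀ m < q, ∀ n < q, ∑ i ∈ range q, conj (c i m) * c i n = if m = n then 1 else 0
  exists_norm_le : ∃ r : ℝ, 0 ≤ r ∧ r < 1 ∧ ∀ m < q, ‖c 0 m‖ ≤ r

/-- The image of a submodule under the `j`-th power of a unitary operator. -/
def dilate (U : H ≃ₗᵢ[ℂ] H) (V : Submodule ℂ H) (j : ℤ) : Submodule ℂ H :=
  V.map ((U ^ j).toLinearEquiv : H →ₗ[ℂ] H)

variable {U : H ≃ₗᵢ[ℂ] H} {q : ℕ} {e : ℕ → H} {w : ℕ → ℕ → H} {c : ℕ → ℕ → ℂ}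

theorem mem_dilate {V : Submodule ℂ H} {j : ℤ} {x : H} (hx : x ∈ V) :
    (U ^ j) x ∈ dilate U V j :=
  Submodule.mem_map_of_mem hx

theorem zpow_add_apply (i j : ℤ) (x : H) : (U ^ (i + j)) x = (U ^ i) ((U ^ j) x) := by
  rw [zpow_add]; rfl

theorem isClosed_dilate {V : Submodule ℂ H} (hV : IsClosed (V : Set H)) (j : ℤ) :
    IsClosed (dilate U V j : Set H) := by
  have : (dilate U V j : Set H) = (U ^ j).toHomeomorph '' V := rfl
  rw [this]
  exact ((U ^ j).toHomeomorph.isClosed_image).2 hV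

namespace IsFilterBank

variable (h : IsFilterBank U q e w c)
include h

/-- Reconstruction: orthogonality of the columns inverts the expansion of `w` in the dilates of `e`.
-/
theorem dilate_scaling_eq {m : ℕ} (hm : m < q) (k : ℕ) :
    U (e (m + q * k)) = ∑ i ∈ range q, conj (c i m) • w i k := by
  have h1 : ∀ i ∈ range q, conj (c i m) • w i k =
      ∑ n ∈ range q, (conj (c i m) * c i n) • U (e (n + q * k)) := fun i hi => by
    rw [h.expansion i (mem_range.1 hi), smul_sum]
    simp only [smul_smul]
  rw [sum_congr rfl h1, sum_comm]
  have h2 : ∀ n ∈ range q, ∑ i ∈ range q, (conj (c i m) * c i n) • U (e (n + q * k)) =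
      if m = n then U (e (n + q * k)) else 0 := fun n hn => by
    rw [← sum_smul, h.col m hm n (mem_range.1 hn)]
    split_ifs <;> simp
  rw [sum_congr rfl h2]
  simp [hm]

theorem add_mul_inj {m n k l : ℕ} (hm : m < q) (hn : n < q) (hkl : m + q * k = n + q * l) :
    m = n ∧ k = l := by
  have h1 := congrArg (· % q) hkl
  have h2 := congrArg (· / q) hkl
  simp only [Nat.add_mul_mod_self_left, Nat.mod_eq_of_lt hm, Nat.mod_eq_of_lt hn] at h1
  simp only [Nat.add_mul_div_left _ _ h.pos, Nat.div_eq_of_lt hm, Nat.div_eq_of_lt hn] at h2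
  omega

/-- The vectors `U (e (m + q * k))` are orthonormal in the pair `(m, k)`, so only the row relations
remain. -/
theorem inner_eq {i j : ℕ} (hi : i < q) (hj : j < q) (k l : ℕ) :
    inner ℂ (w i k) (w j l) = if i = j ∧ k = l then 1 else 0 := by
  classical
  rw [h.expansion i hi, h.expansion j hj, sum_inner]
  have h1 : ∀ m ∈ range q, inner ℂ (c i m • U (e (m + q * k)))
      (∑ n ∈ range q, c j n • U (e (n + q * l))) =
      if k = l then conj (c i m) * c j m else 0 := fun m hm => by
    rw [inner_sum]
    have h2 : ∀ n ∈ range q, inner ℂ (c i m • U (e (m + q * k))) (c j n • U (e (n + q * l))) =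
        if m = n then (if k = l then conj (c i m) * c j m else 0) else 0 := fun n hn => by
      rw [inner_smul_left, inner_smul_right, LinearIsometryEquiv.inner_map_map,
        orthonormal_iff_ite.1 h.orthonormal]
      by_cases hmn : m + q * k = n + q * l
      · obtain ⟨rfl, rfl⟩ := h.add_mul_inj (mem_range.1 hm) (mem_range.1 hn) hmn
        simp
      · rw [if_neg hmn]
        split_ifs with h3 h4
        · exact absurd (by rw [h3, h4]) hmn
        · simp
        · simp
    rw [sum_congr rfl h2, sum_ite_eq, if_pos hm]
  rw [sum_congr rfl h1]
  by_cases hkl : k = l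
  · simp [hkl, h.row i hi j hj]
  · simp [hkl]

theorem scaling_le_dilate : (Submodule.span ℂ (Set.range e)).topologicalClosure ≤
    dilate U (Submodule.span ℂ (Set.range e)).topologicalClosure 1 := by
  refine Submodule.topologicalClosure_minimal _ ?_
    (isClosed_dilate (Submodule.isClosed_topologicalClosure _) 1)
  rw [Submodule.span_le]
  rintro _ ⟨k, rfl⟩
  rw [SetLike.mem_coe, ← h.zero, h.expansion 0 h.pos]
  refine Submodule.sum_mem _ fun m _ => Submodule.smul_mem _ _ ?_
  have := mem_dilate (U := U) (j := 1)
    (Submodule.le_topologicalClosure _ (Submodule.subset_span (R := ℂ) (Set.mem_range_self (f := e) (m + q * k))))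
  simpa using this

theorem dilate_mono :
    Monotone (dilate U (Submodule.span ℂ (Set.range e)).topologicalClosure) := by
  refine monotone_int_of_le_succ fun j => ?_
  rintro _ ⟨x, hx, rfl⟩
  obtain ⟨y, hy, rfl⟩ := h.scaling_le_dilate hx
  refine ⟨y, hy, ?_⟩
  change (U ^ (j + 1)) y = (U ^ j) ((U ^ (1 : ℤ)) y)
  rw [zpow_add_apply]

theorem wavelet_mem {i : ℕ} (hi : i < q) (j : ℤ) (k : ℕ) :
    (U ^ j) (w i k) ∈ dilate U (Submodule.span ℂ (Set.range e)).topologicalClosure (j + 1) := by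
  rw [h.expansion i hi, map_sum]
  refine Submodule.sum_mem _ fun m _ => ?_
  rw [map_smul]
  refine Submodule.smul_mem _ _ ⟨e (m + q * k), ?_, ?_⟩
  · exact Submodule.le_topologicalClosure _ (Submodule.subset_span ⟨_, rfl⟩)
  · change (U ^ (j + 1)) _ = _
    rw [zpow_add_apply]
    simp

theorem inner_wavelet_of_mem {i : ℕ} (h0 : i ≠ 0) (hi : i < q) (j : ℤ) (k : ℕ) {v : H}
    (hv : v ∈ dilate U (Submodule.span ℂ (Set.range e)).topologicalClosure j) :
    inner ℂ v ((U ^ j) (w i k)) = 0 := by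
  obtain ⟨x, hx, rfl⟩ := hv
  change inner ℂ ((U ^ j) x) _ = 0
  rw [LinearIsometryEquiv.inner_map_map]
  have h1 : (Submodule.span ℂ (Set.range e)).topologicalClosure ≤ (ℂ ∙ (w i k))ᗮ := by
    refine Submodule.topologicalClosure_minimal _ ?_ (Submodule.isClosed_orthogonal _)
    rw [Submodule.span_le]
    rintro _ ⟨n, rfl⟩
    rw [SetLike.mem_coe, Submodule.mem_orthogonal_singleton_iff_inner_left, ← h.zero,
      h.inner_eq h.pos hi, if_neg fun hh => h0 hh.1.symm]
  exact Submodule.mem_orthogonal_singleton_iff_inner_left.1 (h1 hx)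

theorem orthonormal_wavelets :
    Orthonormal ℂ (fun a : Fin (q - 1) × ℤ × ℕ => (U ^ a.2.1) (w (a.1 + 1) a.2.2)) := by
  classical
  -- The coarser wavelet lies in the scaling space of level `j + 1 ≤ j'`, which is orthogonal to the
  -- wavelets of level `j'`.
  have key : ∀ {i i' : ℕ} {j j' : ℤ} {k k' : ℕ}, i < q → i' < q → i' ≠ 0 → j < j' →
      inner ℂ ((U ^ j) (w i k)) ((U ^ j') (w i' k')) = 0 := fun hi hi' h0 hj =>
    h.inner_wavelet_of_mem h0 hi' _ _ (h.dilate_mono (Int.add_one_le_iff.2 hj)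
      (h.wavelet_mem hi _ _))
  rw [orthonormal_iff_ite]
  rintro ⟨i, j, k⟩ ⟨i', j', k'⟩
  have hi : (i : ℕ) + 1 < q := by omega
  have hi' : (i' : ℕ) + 1 < q := by omega
  rcases lt_trichotomy j j' with hj | rfl | hj
  · rw [key hi hi' (by omega) hj, if_neg (by simp [hj.ne])]
  · dsimp only
    rw [LinearIsometryEquiv.inner_map_map, h.inner_eq hi hi']
    simp [Prod.ext_iff, Fin.ext_iff]
  · rw [inner_eq_zero_symm.1 (key hi' hi (by omega) hj), if_neg (by simp [hj.ne'])]

/-- In the reconstruction formula only the term `i = 0` survives against `f`, so going down one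
level costs a factor of modulus at most `r < 1`. Iterating and using Cauchy–Schwarz leaves `r ^ l *
‖f‖` for every `l`. -/
theorem inner_scaling_eq_zero {J : ℤ} {f : H}
    (hf : ∀ j < J, ∀ i < q, i ≠ 0 → ∀ k, inner ℂ ((U ^ j) (w i k)) f = 0) (n : ℕ) :
    inner ℂ ((U ^ J) (e n)) f = 0 := by
  obtain ⟨r, hr0, hr1, hr⟩ := h.exists_norm_le
  -- The bound is uniform in `j ≤ J` and `n` because each step replaces `(j + 1, n)` by `(j, n /
  -- q)`.
  have key : ∀ (l : ℕ) (j : ℤ), j ≤ J → ∀ n, ‖inner ℂ ((U ^ j) (e n)) f‖ ≤ r ^ l * ‖f‖ := by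
    intro l
    induction l with
    | zero =>
      intro j _ n
      refine (norm_inner_le_norm _ _).trans ?_
      rw [LinearIsometryEquiv.norm_map, h.orthonormal.1, pow_zero]
    | succ l ih =>
      intro j hj n
      obtain ⟨j, rfl⟩ : ∃ j', j = j' + 1 := ⟨j - 1, by ring⟩
      have hm : n % q < q := Nat.mod_lt _ h.pos
      have h1 : (U ^ (j + 1)) (e n) =
          ∑ i ∈ range q, conj (c i (n % q)) • (U ^ j) (w i (n / q)) := by
        rw [zpow_add_apply, zpow_one]
        conv_lhs => rw [← Nat.mod_add_div n q]
        rw [h.dilate_scaling_eq hm, map_sum]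
        simp only [map_smul]
      rw [h1, sum_inner, sum_eq_single_of_mem 0 (mem_range.2 h.pos), inner_smul_left,
        RingHomCompTriple.comp_apply, RingHom.id_apply, norm_mul, h.zero, pow_succ']
      · rw [mul_assoc]
        exact mul_le_mul (hr _ hm) (ih j (by omega) _) (norm_nonneg _) hr0
      · intro i hi h0
        rw [inner_smul_left, hf j (by omega) i (mem_range.1 hi) h0, mul_zero]
  have hlim : Tendsto (fun l : ℕ => r ^ l * ‖f‖) atTop (𝓝 (0 * ‖f‖)) :=
    (tendsto_pow_atTop_nhds_zero_of_lt_one hr0 hr1).mul_const _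
  rw [zero_mul] at hlim
  exact norm_le_zero_iff.1 (ge_of_tendsto' hlim fun l => key l J le_rfl n)

/-- A vector of the intersection lies in every scaling space, so it is orthogonal to the wavelets of
every level and the contraction argument applies. -/
theorem iInter_dilate (he : ∀ f : H, (∀ (j : ℤ) (n : ℕ), inner ℂ ((U ^ j) (e n)) f = 0) →
    f = 0) :
    ⋂ j : ℤ, (dilate U (Submodule.span ℂ (Set.range e)).topologicalClosure j : Set H) = {0} := by
  refine Set.eq_singleton_iff_unique_mem.2 ⟨Set.mem_iInter.2 fun j => Submodule.zero_mem _, ?_⟩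
  intro f hf
  refine he f fun J n => h.inner_scaling_eq_zero (fun j _ i hi h0 k => ?_) n
  exact inner_eq_zero_symm.1 (h.inner_wavelet_of_mem h0 hi j k (Set.mem_iInter.1 hf j))

variable [CompleteSpace H]

theorem span_wavelets_eq_top (he : ∀ f : H, (∀ (j : ℤ) (n : ℕ), inner ℂ ((U ^ j) (e n)) f = 0) →
    f = 0) :
    (Submodule.span ℂ (Set.range fun a : Fin (q - 1) × ℤ × ℕ =>
      (U ^ a.2.1) (w (a.1 + 1) a.2.2))).topologicalClosure = ⊤ := by
  rw [Submodule.topologicalClosure_eq_top_iff, Submodule.eq_bot_iff]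
  intro f hf
  refine he f fun J n => h.inner_scaling_eq_zero (fun j _ i hi h0 k => ?_) n
  refine (Submodule.mem_orthogonal _ _).1 hf _ (Submodule.subset_span ⟨(⟨i - 1, by omega⟩, j, k), ?_⟩)
  simp [Nat.sub_add_cancel (Nat.pos_of_ne_zero h0)]

theorem closure_negative_eq :
    (Submodule.span ℂ {f | ∃ (j : ℤ) (k : ℕ) (m : Fin (q - 1)), j < 0 ∧
      f = (U ^ j) (w (m + 1) k)}).topologicalClosure =
    (Submodule.span ℂ (Set.range e)).topologicalClosure := by
  refine le_antisymm ?_ ?_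
  · refine Submodule.topologicalClosure_minimal _ ?_ (Submodule.isClosed_topologicalClosure _)
    rw [Submodule.span_le]
    rintro _ ⟨j, k, m, hj, rfl⟩
    have h1 := h.dilate_mono (Int.add_one_le_iff.2 hj)
      (h.wavelet_mem (i := m + 1) (by omega) j k)
    obtain ⟨x, hx, hx'⟩ := h1
    rw [← hx']
    simpa using hx
  · set N := (Submodule.span ℂ {f | ∃ (j : ℤ) (k : ℕ) (m : Fin (q - 1)), j < 0 ∧
      f = (U ^ j) (w (m + 1) k)}) with hN
    refine Submodule.topologicalClosure_minimal _ ?_ (Submodule.isClosed_topologicalClosure _)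
    -- The closure is the double orthogonal complement, so it is enough that each `e n` is
    -- orthogonal to every `f` orthogonal to the negative wavelets: the contraction argument at `J =
    -- 0`.
    rw [Submodule.span_le, ← Submodule.orthogonal_orthogonal_eq_closure]
    rintro _ ⟨n, rfl⟩
    refine (Submodule.mem_orthogonal' _ _).2 fun f hf => ?_
    have := h.inner_scaling_eq_zero (J := 0) (f := f) (fun j hj i hi h0 k => ?_) n
    · simpa using this
    · refine (Submodule.mem_orthogonal _ _).1 hf _ (Submodule.subset_span
        ⟨j, k, ⟨i - 1, by omega⟩, hj, ?_⟩)
      simp [Nat.sub_add_cancel (Nat.pos_of_ne_zero h0)]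

theorem closure_iUnion_dilate
    (he : ∀ f : H, (∀ (j : ℤ) (n : ℕ), inner ℂ ((U ^ j) (e n)) f = 0) → f = 0) :
    closure (⋃ j : ℤ, (dilate U (Submodule.span ℂ (Set.range e)).topologicalClosure j : Set H)) =
      Set.univ := by
  rw [← Submodule.coe_iSup_of_directed _ h.dilate_mono.directed_le,
    ← Submodule.topologicalClosure_coe, ← Submodule.top_coe (R := ℂ), SetLike.coe_set_eq,
    Submodule.topologicalClosure_eq_top_iff, Submodule.eq_bot_iff]
  intro f hf
  refine he f fun j n => (Submodule.mem_orthogonal _ _).1 hf _ (Submodule.mem_iSup_of_mem j ?_)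
  exact mem_dilate (Submodule.le_topologicalClosure _ (Submodule.subset_span ⟨n, rfl⟩))

end IsFilterBank

end Hilbert

/-! ### The sequence `u` represents each coset of `𝒪` in `K` exactly once. -/

section Sequence

variable {K : Type*} [NontriviallyNormedField K] {ϖ : Kˣ} {u : ℕ → K}

theorem IsPrimeElement.one_lt_inv (hϖ : IsPrimeElement ϖ) : 1 < ‖(ϖ : K)‖⁻¹ :=
  (one_lt_inv₀ (norm_pos_iff.2 ϖ.ne_zero)).2 hϖ.1

variable [IsUltrametricDist K]

namespace IsTranslationSequence

variable (hu : IsTranslationSequence ϖ u)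
include hu

theorem residueCard_pos : 0 < residueCard K := by
  obtain ⟨n, ⟨hn, -⟩, -⟩ := hu.complete 0 (by simp)
  exact Nat.zero_lt_of_lt hn

theorem one_lt_residueCard (hϖ : IsPrimeElement ϖ) : 1 < residueCard K := by
  obtain ⟨n, ⟨hn, hn'⟩, -⟩ := hu.complete ((ϖ : K)⁻¹) (by rw [norm_inv])
  rcases Nat.eq_zero_or_pos n with rfl | h0
  · rw [hu.zero, sub_zero, norm_inv] at hn'
    exact absurd hn' (not_le.2 hϖ.one_lt_inv)
  · omega

theorem norm_le {n : ℕ} (hn : n < residueCard K) : ‖u n‖ ≤ ‖(ϖ : K)‖⁻¹ := by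
  rcases Nat.eq_zero_or_pos n with rfl | h0
  · simp [hu.zero]
  · exact (hu.norm_eq n h0 hn).le

theorem norm_mul_le {n : ℕ} (hn : n < residueCard K) : ‖(ϖ : K) * u n‖ ≤ 1 := by
  have h := mul_le_mul_of_nonneg_left (hu.norm_le hn) (norm_nonneg (ϖ : K))
  rwa [mul_inv_cancel₀ (norm_ne_zero_iff.2 ϖ.ne_zero), ← norm_mul] at h

theorem norm_le_inv {n : ℕ} (hn : n < residueCard K) (hϖ : IsPrimeElement ϖ) {x : K}
    (hx : ‖x - u n‖ ≤ 1) : ‖x‖ ≤ ‖(ϖ : K)‖⁻¹ := by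
  have := IsUltrametricDist.norm_add_le_max (x - u n) (u n)
  rw [sub_add_cancel] at this
  exact this.trans (max_le (hx.trans hϖ.one_lt_inv.le) (hu.norm_le hn))

/-- Splitting off the lowest base-`q` digit `m` shifts the remaining digits by one power of `ϖ⁻¹`.
-/
theorem apply_add_mul (hϖ : IsPrimeElement ϖ) {m : ℕ} (hm : m < residueCard K) (k : ℕ) :
    u (m + residueCard K * k) = u m + (ϖ : K)⁻¹ * u k := by
  have hq := hu.one_lt_residueCard hϖ
  rcases Nat.eq_zero_or_pos (m + residueCard K * k) with h0 | h0
  · obtain ⟨rfl, h1⟩ := Nat.add_eq_zero_iff.1 h0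
    rcases Nat.mul_eq_zero.1 h1 with h2 | rfl
    · omega
    · simp [hu.zero]
  · have h1 : (m + residueCard K * k) % residueCard K = m := by
      simp [Nat.mod_eq_of_lt hm]
    have h2 : (m + residueCard K * k) / residueCard K = k := by
      rw [Nat.add_mul_div_left _ _ (by omega), Nat.div_eq_of_lt hm, zero_add]
    rw [hu.expansion (m + _), Nat.digits_def' hq h0, List.length_cons, Finset.sum_range_succ', h2]
    conv_rhs => rw [hu.expansion k, Finset.mul_sum]
    rw [pow_zero, pow_zero, Nat.div_one, h1, inv_one, mul_one, add_comm]
    congr 1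
    refine Finset.sum_congr rfl fun i _ => ?_
    rw [pow_succ', ← Nat.div_div_eq_div_mul, h2, pow_succ', mul_inv]
    ring

theorem exists_norm_sub_le (hϖ : IsPrimeElement ϖ) (x : K) : ∃ n, ‖x - u n‖ ≤ 1 := by
  have hpos : 0 < ‖(ϖ : K)‖ := norm_pos_iff.2 ϖ.ne_zero
  have key : ∀ (l : ℕ) (x : K), ‖x‖ ≤ ‖(ϖ : K)‖⁻¹ ^ l → ∃ n, ‖x - u n‖ ≤ 1 := by
    intro l
    induction l with
    | zero => exact fun x hx => ⟨0, by simpa [hu.zero] using hx⟩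
    | succ l ih =>
      intro x hx
      -- The high digits `k` come from `ϖ x`, which is one scale smaller; the remainder `x - ϖ⁻¹
      -- u(k)` lies in `𝔓⁻¹`, where completeness provides the lowest digit.
      obtain ⟨k, hk⟩ := ih ((ϖ : K) * x) (by
        rw [norm_mul]
        calc ‖(ϖ : K)‖ * ‖x‖ ≤ ‖(ϖ : K)‖ * ‖(ϖ : K)‖⁻¹ ^ (l + 1) := by gcongr
          _ = ‖(ϖ : K)‖⁻¹ ^ l := by
            rw [pow_succ', ← mul_assoc, mul_inv_cancel₀ hpos.ne', one_mul])
      obtain ⟨m, ⟨hm, hm'⟩, -⟩ := hu.complete (x - (ϖ : K)⁻¹ * u k) (by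
        have : x - (ϖ : K)⁻¹ * u k = (ϖ : K)⁻¹ * ((ϖ : K) * x - u k) := by
          rw [mul_sub, ← mul_assoc, inv_mul_cancel₀ ϖ.ne_zero, one_mul]
        rw [this, norm_mul, norm_inv]
        exact mul_le_of_le_one_right (by positivity) hk)
      refine ⟨m + residueCard K * k, ?_⟩
      rwa [hu.apply_add_mul hϖ hm, add_comm, ← sub_sub]
  obtain ⟨l, hl⟩ := pow_unbounded_of_one_lt ‖x‖ hϖ.one_lt_inv
  exact key l x hl.le

theorem eq_of_norm_sub_le (hϖ : IsPrimeElement ϖ) (n : ℕ) :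
    ∀ (x : K) (m : ℕ), ‖x - u n‖ ≤ 1 → ‖x - u m‖ ≤ 1 → n = m := by
  have hq := hu.one_lt_residueCard hϖ
  -- Multiplication by `ϖ` deletes the lowest digit modulo `𝒪`.
  have step : ∀ (x : K) (n : ℕ), ‖x - u n‖ ≤ 1 →
      ‖(ϖ : K) * x - u (n / residueCard K)‖ ≤ 1 := by
    intro x n hx
    have hr : n % residueCard K < residueCard K := Nat.mod_lt _ (by omega)
    have h1 := hu.apply_add_mul hϖ hr (n / residueCard K)
    rw [Nat.mod_add_div] at h1
    have h2 : (ϖ : K) * x - u (n / residueCard K) =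
        (ϖ : K) * (x - u n) + (ϖ : K) * u (n % residueCard K) := by
      rw [h1, mul_sub, mul_add, ← mul_assoc, mul_inv_cancel₀ ϖ.ne_zero]
      ring
    rw [h2]
    refine (IsUltrametricDist.norm_add_le_max _ _).trans (max_le ?_ (hu.norm_mul_le hr))
    rw [norm_mul]
    exact mul_le_one₀ hϖ.1.le (norm_nonneg _) hx
  have base : ∀ (x : K) (n m : ℕ), ‖x - u n‖ ≤ 1 → ‖x - u m‖ ≤ 1 →
      n / residueCard K = m / residueCard K → n = m := by
    intro x n m hn hm hnm
    have hr : n % residueCard K < residueCard K := Nat.mod_lt _ (by omega)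
    have hr' : m % residueCard K < residueCard K := Nat.mod_lt _ (by omega)
    have h1 := hu.apply_add_mul hϖ hr (n / residueCard K)
    have h2 := hu.apply_add_mul hϖ hr' (m / residueCard K)
    rw [Nat.mod_add_div] at h1 h2
    rw [h1, add_comm, ← sub_sub] at hn
    rw [h2, add_comm, ← sub_sub, ← hnm] at hm
    have h3 := (hu.complete _ (hu.norm_le_inv hr hϖ hn)).unique ⟨hr, hn⟩ ⟨hr', hm⟩
    rw [← Nat.mod_add_div n (residueCard K), ← Nat.mod_add_div m (residueCard K), h3, hnm]
  -- Induction on a common bound for the indices: division by `q > 1` lowers positive indices, and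
  -- `base` recovers the lowest digit.
  have main : ∀ (N : ℕ) (x : K) (n m : ℕ), n ≤ N → m ≤ N → ‖x - u n‖ ≤ 1 → ‖x - u m‖ ≤ 1 →
      n = m := by
    intro N
    induction N with
    | zero => intro x n m hn hm _ _; omega
    | succ N ih =>
      intro x n m hn hm hxn hxm
      have hdiv : ∀ l ≤ N + 1, l / residueCard K ≤ N := fun l hl => by
        rcases Nat.eq_zero_or_pos l with rfl | h0
        · simp
        · have := Nat.div_lt_self h0 hq
          omega
      exact base x n m hxn hxm (ih _ _ _ (hdiv n hn) (hdiv m hm) (step x n hxn) (step x m hxm))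
  exact fun x m => main (max n m) x n m (le_max_left _ _) (le_max_right _ _)

end IsTranslationSequence

end Sequence

/-! ### Integrals over balls determine a locally integrable function. -/

section Density

variable {K : Type*} [NontriviallyNormedField K] [IsUltrametricDist K]

theorem isTopologicalBasis_closedBall_zpow {ϖ : Kˣ} (hϖ : ‖(ϖ : K)‖ < 1) :
    TopologicalSpace.IsTopologicalBasis
      {B : Set K | ∃ (s : K) (j : ℤ), Metric.closedBall s (‖(ϖ : K)‖ ^ j) = B} := by
  have hpos : 0 < ‖(ϖ : K)‖ := norm_pos_iff.2 ϖ.ne_zero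
  refine TopologicalSpace.isTopologicalBasis_of_isOpen_of_nhds ?_ ?_
  · rintro _ ⟨s, j, rfl⟩
    exact IsUltrametricDist.isOpen_closedBall _ (zpow_pos hpos j).ne'
  · intro x U hx hU
    obtain ⟨ε, hε, h⟩ := Metric.nhds_basis_closedBall.mem_iff.1 (hU.mem_nhds hx)
    obtain ⟨n, hn⟩ := exists_pow_lt_of_lt_one hε hϖ
    refine ⟨_, ⟨x, n, rfl⟩, Metric.mem_closedBall_self (zpow_pos hpos _).le,
      (Metric.closedBall_subset_closedBall ?_).trans h⟩
    rw [zpow_natCast]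
    exact hn.le

/-- Two ultrametric balls that meet can be recentred at a common point, and then one contains the
other. -/
theorem isPiSystem_closedBall_zpow (ϖ : Kˣ) :
    IsPiSystem {B : Set K | ∃ (s : K) (j : ℤ), Metric.closedBall s (‖(ϖ : K)‖ ^ j) = B} := by
  rintro _ ⟨s, j, rfl⟩ _ ⟨t, k, rfl⟩ ⟨z, hz⟩
  rw [IsUltrametricDist.closedBall_eq_of_mem hz.1, IsUltrametricDist.closedBall_eq_of_mem hz.2]
  rcases le_total (‖(ϖ : K)‖ ^ j) (‖(ϖ : K)‖ ^ k) with h | h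
  · exact ⟨z, j, (Set.inter_eq_left.2 (Metric.closedBall_subset_closedBall h)).symm⟩
  · exact ⟨z, k, (Set.inter_eq_right.2 (Metric.closedBall_subset_closedBall h)).symm⟩

variable [LocallyCompactSpace K] [MeasurableSpace K] [BorelSpace K] {μ : Measure K}

/-- A π-λ argument inside each large ball, where `f` is integrable, extends the vanishing from balls
to all Borel sets; countably many such balls cover `K`. -/
theorem ae_eq_zero_of_forall_closedBall [IsFiniteMeasureOnCompacts μ] {ϖ : Kˣ}
    (hϖ : ‖(ϖ : K)‖ < 1) {f : K → ℂ} (hf : LocallyIntegrable f μ)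
    (h : ∀ (s : K) (j : ℤ), ∫ x in Metric.closedBall s (‖(ϖ : K)‖ ^ j), f x ∂μ = 0) :
    f =ᵐ[μ] 0 := by
  have : ProperSpace K := ProperSpace.of_locallyCompactSpace K
  have hpos : 0 < ‖(ϖ : K)‖ := norm_pos_iff.2 ϖ.ne_zero
  have hint : ∀ n : ℕ, IntegrableOn f (Metric.closedBall 0 (‖(ϖ : K)‖ ^ (-n : ℤ))) μ := fun n =>
    hf.integrableOn_isCompact (isCompact_closedBall _ _)
  have hloc : ∀ n : ℕ, f =ᵐ[μ.restrict (Metric.closedBall 0 (‖(ϖ : K)‖ ^ (-n : ℤ)))] 0 := by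
    intro n
    refine (hint n).ae_eq_zero_of_forall_setIntegral_eq_zero fun S hS _ => ?_
    induction S, hS using MeasurableSpace.induction_on_inter
      (BorelSpace.measurable_eq.trans (isTopologicalBasis_closedBall_zpow hϖ).borel_eq_generateFrom)
      (isPiSystem_closedBall_zpow ϖ) with
    | empty => simp
    | basic S hS =>
      rw [Measure.restrict_restrict]
      · by_cases hne : (S ∩ Metric.closedBall 0 (‖(ϖ : K)‖ ^ (-n : ℤ))).Nonempty
        · obtain ⟨s, j, hs⟩ := isPiSystem_closedBall_zpow ϖ _ hS _ ⟨0, -n, rfl⟩ hne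
          rw [← hs, h]
        · rw [Set.not_nonempty_iff_eq_empty.1 hne]
          simp
      · obtain ⟨s, j, rfl⟩ := hS
        exact Metric.isClosed_closedBall.measurableSet
    | compl S hS ih =>
      have := integral_add_compl hS (hint n)
      rw [ih (measure_lt_top_of_subset (Set.subset_univ _) (by
        rw [Measure.restrict_apply_univ]
        exact (isCompact_closedBall _ _).measure_lt_top.ne)), zero_add, h] at this
      exact this
    | iUnion S hd hS ih =>
      rw [integral_iUnion hS hd (hint n).integrableOn]
      refine (tsum_congr fun i => ih i (measure_lt_top_of_subset (Set.subset_univ _) (by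
        rw [Measure.restrict_apply_univ]
        exact (isCompact_closedBall _ _).measure_lt_top.ne))).trans tsum_zero
  have hU : ⋃ n : ℕ, Metric.closedBall (0 : K) (‖(ϖ : K)‖ ^ (-n : ℤ)) = Set.univ := by
    refine Set.eq_univ_of_forall fun x => ?_
    obtain ⟨n, hn⟩ := pow_unbounded_of_one_lt ‖x‖ ((one_lt_inv₀ hpos).2 hϖ)
    refine Set.mem_iUnion.2 ⟨n, ?_⟩
    rw [mem_closedBall_zero_iff, zpow_neg, zpow_natCast, ← inv_pow]
    exact hn.le
  rw [← Measure.restrict_univ (μ := μ), ← hU]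
  exact (ae_restrict_iUnion_iff _ _).2 hloc

end Density

/-! ### Characters on balls, and injectivity of the Fourier transform. -/

section Character

open Metric

variable {K : Type*} [NontriviallyNormedField K] {ϖ : Kˣ} {χ : AddChar K Circle}

/-- There is no absolute value strictly between `1` and `‖ϖ‖⁻¹`, so `‖y * a‖ > 1` forces `y a 𝒪 ⊇
𝔓⁻¹`, where `χ` is nontrivial. -/
theorem exists_apply_mul_ne_one (hϖ : IsPrimeElement ϖ)
    (hχ_ne : ∃ x : K, ‖x‖ ≤ ‖(ϖ : K)‖⁻¹ ∧ χ x ≠ 1) (a : Kˣ) {y : K} (hy : 1 < ‖y * a‖) :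
    ∃ x : K, ‖x‖ ≤ ‖(a : K)‖ ∧ χ (y * x) ≠ 1 := by
  obtain ⟨x, hx, hx'⟩ := hχ_ne
  have hpos : 0 < ‖(ϖ : K)‖ := norm_pos_iff.2 ϖ.ne_zero
  have hy0 : y ≠ 0 := by
    rintro rfl
    simp at hy
    linarith
  have ha0 : 0 < ‖(a : K)‖ := norm_pos_iff.2 a.ne_zero
  have hy1 : 0 < ‖y‖ := norm_pos_iff.2 hy0
  refine ⟨x / y, ?_, by rwa [mul_div_cancel₀ _ hy0]⟩
  have h1 := hϖ.2 (y * a)⁻¹ (by rw [norm_inv]; exact inv_lt_one_of_one_lt₀ hy)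
  rw [norm_inv, norm_mul] at h1
  rw [norm_div, div_le_iff₀ hy1]
  refine hx.trans ?_
  rw [mul_comm]
  exact inv_le_of_inv_le₀ (by positivity) h1

/-- The function `x ↦ χ (b x)` restricted to the ball of radius `r` around `s`. -/
noncomputable def ballChar (χ : AddChar K Circle) (b s : K) (r : ℝ) : K → ℂ :=
  (closedBall s r).indicator fun x => (χ (b * x) : ℂ)

theorem ballChar_zero (s : K) (r : ℝ) :
    ballChar χ 0 s r = (closedBall s r).indicator fun _ => 1 := by
  simp [ballChar]

variable [MeasurableSpace K] [BorelSpace K] {μ : Measure K} [μ.IsAddHaarMeasure]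

theorem memLp_ballChar [LocallyCompactSpace K] (hχ : Continuous χ) (b s : K) (r : ℝ) (p : ENNReal) :
    MemLp (ballChar χ b s r) p μ := by
  have : ProperSpace K := ProperSpace.of_locallyCompactSpace K
  have : IsFiniteMeasure (μ.restrict (closedBall s r)) :=
    ⟨by rw [Measure.restrict_apply_univ]; exact (isCompact_closedBall s r).measure_lt_top⟩
  rw [ballChar, memLp_indicator_iff_restrict isClosed_closedBall.measurableSet]
  refine MemLp.of_bound (C := 1) ?_ (ae_of_all _ fun x => (Circle.norm_coe _).le)
  exact Continuous.aestronglyMeasurable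
    (continuous_subtype_val.comp (hχ.comp (continuous_const.mul continuous_id)))

variable [IsUltrametricDist K]

/-- Orthogonality of characters: either the integrand is `1` on the ball, or a translation
preserving the ball multiplies the integral by a number different from `1`. -/
theorem integral_ballChar (hϖ : IsPrimeElement ϖ) (hχ_one : ∀ x : K, ‖x‖ ≤ 1 → χ x = 1)
    (hχ_ne : ∃ x : K, ‖x‖ ≤ ‖(ϖ : K)‖⁻¹ ∧ χ x ≠ 1) (a : Kˣ) (y : K) :
    ∫ x, ballChar χ y 0 ‖(a : K)‖ x ∂μ =
      if ‖y * a‖ ≤ 1 then (μ.real (closedBall 0 ‖(a : K)‖) : ℂ) else 0 := by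
  have hmeas : MeasurableSet (closedBall (0 : K) ‖(a : K)‖) := isClosed_closedBall.measurableSet
  split_ifs with h
  · rw [ballChar, integral_indicator hmeas, setIntegral_congr_fun (g := fun _ => (1 : ℂ)) hmeas]
    · simp
    · intro x hx
      simp only
      rw [hχ_one, Circle.coe_one]
      rw [mem_closedBall_zero_iff] at hx
      rw [norm_mul] at h ⊢
      exact (mul_le_mul_of_nonneg_left hx (norm_nonneg _)).trans h
  · obtain ⟨t, ht, ht'⟩ := exists_apply_mul_ne_one hϖ hχ_ne a (not_le.1 h)
    have h1 : ∀ x, ballChar χ y 0 ‖(a : K)‖ (x + t) = χ (y * t) * ballChar χ y 0 ‖(a : K)‖ x := by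
      intro x
      have hiff : x + t ∈ closedBall (0 : K) ‖(a : K)‖ ↔ x ∈ closedBall (0 : K) ‖(a : K)‖ := by
        rw [mem_closedBall_zero_iff, mem_closedBall_zero_iff]
        refine ⟨fun hx => ?_, fun hx =>
          (IsUltrametricDist.norm_add_le_max _ _).trans (max_le hx ht)⟩
        have := IsUltrametricDist.norm_add_le_max (x + t) (-t)
        rw [add_neg_cancel_right, norm_neg] at this
        exact this.trans (max_le hx ht)
      by_cases hx : x ∈ closedBall (0 : K) ‖(a : K)‖
      · rw [ballChar, Set.indicator_of_mem hx, Set.indicator_of_mem (hiff.2 hx), mul_add,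
          AddChar.map_add_eq_mul, Circle.coe_mul, mul_comm]
      · rw [ballChar, Set.indicator_of_notMem hx, Set.indicator_of_notMem (mt hiff.1 hx), mul_zero]
    have h2 := integral_add_right_eq_self (μ := μ) (ballChar χ y 0 ‖(a : K)‖) t
    simp only [h1] at h2
    rw [integral_const_mul] at h2
    by_contra h0
    exact ht' (Circle.ext (by simpa using mul_right_cancel₀ h0 (h2.trans (one_mul _).symm)))

theorem fourierIntegral_ballChar (hϖ : IsPrimeElement ϖ) (hχ_one : ∀ x : K, ‖x‖ ≤ 1 → χ x = 1)
    (hχ_ne : ∃ x : K, ‖x‖ ≤ ‖(ϖ : K)‖⁻¹ ∧ χ x ≠ 1) (a : Kˣ) (s : K) :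
    Fourier.fourierIntegral χ μ (ballChar χ s 0 ‖(a : K)‖) =
      (closedBall s ‖(a : K)‖⁻¹).indicator
        fun _ => (μ.real (closedBall (0 : K) ‖(a : K)‖) : ℂ) := by
  classical
  ext x
  have h1 : ∀ v, χ (-(v * x)) • ballChar χ s 0 ‖(a : K)‖ v =
      ballChar χ (s - x) 0 ‖(a : K)‖ v := by
    intro v
    by_cases hv : v ∈ closedBall (0 : K) ‖(a : K)‖
    · rw [ballChar, ballChar, Set.indicator_of_mem hv, Set.indicator_of_mem hv, Circle.smul_def,
        smul_eq_mul, ← Circle.coe_mul, ← AddChar.map_add_eq_mul]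
      congr 2
      ring
    · rw [ballChar, ballChar, Set.indicator_of_notMem hv, Set.indicator_of_notMem hv, smul_zero]
  rw [Fourier.fourierIntegral_def]
  simp only [h1]
  rw [integral_ballChar hϖ hχ_one hχ_ne, Set.indicator_apply]
  refine if_congr ?_ rfl rfl
  rw [mem_closedBall, dist_comm, dist_eq_norm, norm_mul,
    ← le_div_iff₀ (norm_pos_iff.2 a.ne_zero), one_div]

variable [LocallyCompactSpace K]

/-- The multiplication formula against a cut-off character, whose transform is a multiple of the
indicator of a ball. It holds for the integrable approximants and passes to the `L²` limit on both
sides. -/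
theorem HasFourierTransform.setIntegral_eq (hϖ : IsPrimeElement ϖ) (hχ : Continuous χ)
    (hχ_one : ∀ x : K, ‖x‖ ≤ 1 → χ x = 1)
    (hχ_ne : ∃ x : K, ‖x‖ ≤ ‖(ϖ : K)‖⁻¹ ∧ χ x ≠ 1) {f : Lp ℂ 2 μ} {g : K → ℂ}
    (hfg : HasFourierTransform μ χ f g) (a : Kˣ) (s : K) :
    (∫ x in closedBall s ‖(a : K)‖⁻¹, f x ∂μ) * (μ.real (closedBall (0 : K) ‖(a : K)‖) : ℂ) =
      ∫ ξ, g ξ * ballChar χ s 0 ‖(a : K)‖ ξ ∂μ := by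
  have : ProperSpace K := ProperSpace.of_locallyCompactSpace K
  obtain ⟨hg, F, hF, hFf, hFg⟩ := hfg
  have hh : MemLp (ballChar χ s 0 ‖(a : K)‖) 2 μ := memLp_ballChar hχ s 0 _ 2
  have hB : MeasurableSet (closedBall s ‖(a : K)‖⁻¹) := isClosed_closedBall.measurableSet
  have hBμ : μ (closedBall s ‖(a : K)‖⁻¹) ≠ ⊤ := (isCompact_closedBall _ _).measure_lt_top.ne
  have hcont : ∀ n, Continuous (Fourier.fourierIntegral χ μ (F n)) := fun n =>
    VectorFourier.fourierIntegral_continuous (L := LinearMap.mul K K) hχ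
      (by exact continuous_mul) (hF n)
  have h1 : Tendsto (fun n => (∫ x in closedBall s ‖(a : K)‖⁻¹, F n x ∂μ) *
      (μ.real (closedBall (0 : K) ‖(a : K)‖) : ℂ)) atTop
      (𝓝 ((∫ x in closedBall s ‖(a : K)‖⁻¹, f x ∂μ) *
        (μ.real (closedBall (0 : K) ‖(a : K)‖) : ℂ))) := by
    refine Tendsto.mul_const _ ?_
    have h2 := (tendsto_const_nhds (x := indicatorConstLp 2 hB hBμ (1 : ℂ))).inner (𝕜 := ℂ) hFf
    simpa only [L2.inner_indicatorConstLp_one] using h2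
  have h3 : ∀ n, (∫ x in closedBall s ‖(a : K)‖⁻¹, F n x ∂μ) *
      (μ.real (closedBall (0 : K) ‖(a : K)‖) : ℂ) =
      ∫ ξ, Fourier.fourierIntegral χ μ (F n) ξ * ballChar χ s 0 ‖(a : K)‖ ξ ∂μ := by
    intro n
    have h4 := VectorFourier.integral_fourierIntegral_smul_eq_flip (L := LinearMap.mul K K)
      (μ := μ) (ν := μ) hχ (by exact continuous_mul) (hF n)
      (memLp_one_iff_integrable.1 (memLp_ballChar (μ := μ) hχ s 0 ‖(a : K)‖ 1))
    have h5 : (LinearMap.mul K K).flip = LinearMap.mul K K := by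
      ext; simp
    rw [h5] at h4
    change ∫ ξ, Fourier.fourierIntegral χ μ (F n) ξ • ballChar χ s 0 ‖(a : K)‖ ξ ∂μ =
      ∫ x, F n x • Fourier.fourierIntegral χ μ (ballChar χ s 0 ‖(a : K)‖) x ∂μ at h4
    rw [fourierIntegral_ballChar hϖ hχ_one hχ_ne] at h4
    simp only [smul_eq_mul] at h4
    rw [h4, ← integral_mul_const, ← integral_indicator hB]
    refine integral_congr_ae (ae_of_all _ fun x => ?_)
    by_cases hx : x ∈ closedBall s ‖(a : K)‖⁻¹
    · simp only [Set.indicator_of_mem hx]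
    · simp only [Set.indicator_of_notMem hx, mul_zero]
  simp only [h3] at h1
  refine tendsto_nhds_unique h1 ?_
  have hint : ∀ {g' : K → ℂ}, MemLp g' 2 μ →
      Integrable (fun ξ => g' ξ * ballChar χ s 0 ‖(a : K)‖ ξ) μ := fun hg' =>
    memLp_one_iff_integrable.1 (hh.mul hg')
  have hbound : ∀ᶠ n in atTop,
      ‖(∫ ξ, Fourier.fourierIntegral χ μ (F n) ξ * ballChar χ s 0 ‖(a : K)‖ ξ ∂μ) -
        ∫ ξ, g ξ * ballChar χ s 0 ‖(a : K)‖ ξ ∂μ‖ₑ ≤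
      eLpNorm (Fourier.fourierIntegral χ μ (F n) - g) 2 μ *
        eLpNorm (ballChar χ s 0 ‖(a : K)‖) 2 μ := by
    -- Only once the `L²` distance to `g` is finite is the transform of `F n` known to be in `L²`,
    -- as Hölder's inequality requires.
    filter_upwards [hFg.eventually (gt_mem_nhds ENNReal.zero_lt_top)] with n hn
    have hd : MemLp (Fourier.fourierIntegral χ μ (F n) - g) 2 μ :=
      ⟨(hcont n).aestronglyMeasurable.sub hg.1, hn⟩
    have hFn : MemLp (Fourier.fourierIntegral χ μ (F n)) 2 μ := by
      simpa using hd.add hg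
    rw [← integral_sub (hint hFn) (hint hg)]
    refine (enorm_integral_le_lintegral_enorm _).trans ?_
    have h6 := eLpNorm_smul_le_mul_eLpNorm (p := 2) (q := 2) (r := 1) hh.1 hd.1
    rw [eLpNorm_one_eq_lintegral_enorm] at h6
    refine le_trans (le_of_eq ?_) h6
    refine lintegral_congr fun x => ?_
    simp [sub_mul]
  have hz : Tendsto (fun n => eLpNorm (Fourier.fourierIntegral χ μ (F n) - g) 2 μ *
      eLpNorm (ballChar χ s 0 ‖(a : K)‖) 2 μ) atTop (𝓝 0) := by
    have := ENNReal.Tendsto.mul_const (b := eLpNorm (ballChar χ s 0 ‖(a : K)‖) 2 μ) hFg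
      (Or.inr hh.2.ne)
    rwa [zero_mul] at this
  rw [tendsto_iff_norm_sub_tendsto_zero]
  have hz' := tendsto_of_tendsto_of_tendsto_of_le_of_le' tendsto_const_nhds hz
    (Eventually.of_forall fun _ => zero_le) hbound
  have := (ENNReal.tendsto_toReal ENNReal.zero_ne_top).comp hz'
  simpa [Function.comp_def] using this

theorem HasFourierTransform.unique (hϖ : IsPrimeElement ϖ) (hχ : Continuous χ)
    (hχ_one : ∀ x : K, ‖x‖ ≤ 1 → χ x = 1)
    (hχ_ne : ∃ x : K, ‖x‖ ≤ ‖(ϖ : K)‖⁻¹ ∧ χ x ≠ 1) {f f' : Lp ℂ 2 μ} {g : K → ℂ}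
    (hf : HasFourierTransform μ χ f g) (hf' : HasFourierTransform μ χ f' g) : f = f' := by
  have : ProperSpace K := ProperSpace.of_locallyCompactSpace K
  have hloc : ∀ f : Lp ℂ 2 μ, LocallyIntegrable f μ := fun f =>
    (Lp.memLp f).locallyIntegrable (by norm_num)
  have h0 : (fun x => f x - f' x) =ᵐ[μ] 0 := by
    refine ae_eq_zero_of_forall_closedBall hϖ.1 ((hloc f).sub (hloc f')) fun s j => ?_
    have h1 := (hf.setIntegral_eq hϖ hχ hχ_one hχ_ne (ϖ ^ (-j)) s).trans
      (hf'.setIntegral_eq hϖ hχ hχ_one hχ_ne (ϖ ^ (-j)) s).symm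
    have h2 : ‖((ϖ ^ (-j) : Kˣ) : K)‖⁻¹ = ‖(ϖ : K)‖ ^ j := by simp
    have h3 : (μ.real (closedBall (0 : K) ‖((ϖ ^ (-j) : Kˣ) : K)‖) : ℂ) ≠ 0 := by
      rw [Complex.ofReal_ne_zero]
      exact (ENNReal.toReal_pos (measure_closedBall_pos _ _
        (norm_pos_iff.2 (Units.ne_zero _))).ne' (isCompact_closedBall _ _).measure_lt_top.ne).ne'
    rw [h2] at h1
    rw [integral_sub, mul_right_cancel₀ h3 h1, sub_self]
    · exact (hloc f).integrableOn_isCompact (isCompact_closedBall _ _)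
    · exact (hloc f').integrableOn_isCompact (isCompact_closedBall _ _)
  exact Lp.ext (h0.mono fun x hx => sub_eq_zero.1 hx)

theorem hasFourierTransform_ballChar (hμ : μ {x : K | ‖x‖ ≤ 1} = 1) (hϖ : IsPrimeElement ϖ)
    (hχ : Continuous χ) (hχ_one : ∀ x : K, ‖x‖ ≤ 1 → χ x = 1)
    (hχ_ne : ∃ x : K, ‖x‖ ≤ ‖(ϖ : K)‖⁻¹ ∧ χ x ≠ 1) (s : K) :
    HasFourierTransform μ χ ((memLp_ballChar hχ s 0 1 2).toLp (ballChar χ s 0 1))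
      ({ξ : K | ‖ξ - s‖ ≤ 1}.indicator fun _ => 1) := by
  have hball : ∀ s : K, {ξ : K | ‖ξ - s‖ ≤ 1} = closedBall s 1 := fun s => by
    ext; simp [dist_eq_norm]
  have hμ' : μ.real (closedBall (0 : K) 1) = 1 := by
    rw [← hball]; simp [Measure.real, hμ]
  have hfour := fourierIntegral_ballChar (μ := μ) hϖ hχ_one hχ_ne 1 s
  simp only [Units.val_one, norm_one, inv_one, hμ', Complex.ofReal_one] at hfour
  rw [hball]
  -- The function is itself integrable, so a constant approximating sequence suffices.
  refine ⟨?_, fun _ => (memLp_ballChar hχ s 0 1 2).toLp (ballChar χ s 0 1), fun _ => ?_,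
    tendsto_const_nhds, ?_⟩
  · rw [← ballChar_zero (χ := χ)]
    exact memLp_ballChar hχ _ _ _ _
  · exact (memLp_one_iff_integrable.1 (memLp_ballChar hχ s 0 1 1)).congr (MemLp.coeFn_toLp _).symm
  · have : Fourier.fourierIntegral χ μ ((memLp_ballChar (μ := μ) hχ s 0 1 2).toLp
        (ballChar χ s 0 1)) = (closedBall s 1).indicator fun _ => 1 := by
      rw [← hfour]
      exact VectorFourier.fourierIntegral_congr_ae _ _ _ (MemLp.coeFn_toLp _)
    simp [this]

end Character

/-! ### Group laws for translations and dilations. -/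

section Operators

variable {K : Type*} [NontriviallyNormedField K] [MeasurableSpace K] [BorelSpace K]
  {μ : Measure K} [μ.IsAddHaarMeasure]

theorem translation_ae_eq {f : Lp ℂ 2 μ} {g : K → ℂ} (hfg : f =ᵐ[μ] g) (a : K) :
    translation μ a f =ᵐ[μ] fun x => g (x - a) :=
  (Lp.coeFn_compMeasurePreserving f (measurePreserving_sub_right μ a)).trans
    ((measurePreserving_sub_right μ a).quasiMeasurePreserving.ae hfg)

theorem norm_translation (a : K) (f : Lp ℂ 2 μ) : ‖translation μ a f‖ = ‖f‖ :=
  Lp.norm_compMeasurePreserving f (measurePreserving_sub_right μ a)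

theorem translation_translation (a b : K) (f : Lp ℂ 2 μ) :
    translation μ a (translation μ b f) = translation μ (a + b) f := by
  refine Lp.ext ((translation_ae_eq (translation_ae_eq .rfl b) a).trans
    (EventuallyEq.trans ?_ (translation_ae_eq .rfl (a + b)).symm))
  exact ae_of_all _ fun x => by simp only [sub_sub]

theorem translation_zero (f : Lp ℂ 2 μ) : translation μ 0 f = f :=
  Lp.ext ((translation_ae_eq .rfl 0).trans (ae_of_all _ fun x => by simp only [sub_zero]))

variable [LocallyCompactSpace K] [IsUltrametricDist K] {ϖ : Kˣ}

theorem dilation_ae_eq {f : Lp ℂ 2 μ} {g : K → ℂ} (hfg : f =ᵐ[μ] g) (j : ℤ) :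
    dilation μ ϖ j f =ᵐ[μ] fun x => (((residueCard K : ℝ) ^ ((j : ℝ) / 2) : ℝ) : ℂ) *
      g (((ϖ ^ (-j) : Kˣ) : K) * x) := by
  refine (MemLp.coeFn_toLp (memLp_comp_mul μ (ϖ ^ (-j)) _ f)).trans ?_
  filter_upwards [(quasiMeasurePreserving_mul μ (ϖ ^ (-j))).ae hfg] with x hx
  rw [hx]

theorem dilation_zero (f : Lp ℂ 2 μ) : dilation μ ϖ 0 f = f :=
  Lp.ext ((dilation_ae_eq .rfl 0).trans (ae_of_all _ fun x => by simp))

theorem dilation_add (hq : 0 < residueCard K) (i j : ℤ) (f : Lp ℂ 2 μ) :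
    dilation μ ϖ (i + j) f = dilation μ ϖ i (dilation μ ϖ j f) := by
  refine Lp.ext ((dilation_ae_eq .rfl (i + j)).trans
    (EventuallyEq.trans ?_ (dilation_ae_eq (dilation_ae_eq .rfl j) i).symm))
  refine ae_of_all _ fun x => ?_
  have hq' : (0 : ℝ) < residueCard K := Nat.cast_pos.2 hq
  simp only
  rw [← mul_assoc, ← mul_assoc, ← Units.val_mul, ← zpow_add, ← Complex.ofReal_mul,
    ← Real.rpow_add hq']
  congr 3
  · push_cast; ring_nf
  · congr 1; ring_nf

end Operators

/-! ### The concrete filter bank. -/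

section Wavelet

open Metric Finset ComplexConjugate

variable {K : Type*} [NontriviallyNormedField K] [IsUltrametricDist K] {ϖ : Kˣ} {u : ℕ → K}
  {χ : AddChar K Circle}

theorem closedBall_eq_of_norm_sub_le {s t : K} {r : ℝ} (h : ‖s - t‖ ≤ r) :
    closedBall s r = closedBall t r :=
  (IsUltrametricDist.closedBall_eq_of_mem (by rwa [mem_closedBall, dist_eq_norm])).symm

theorem ballChar_eq_sum (hu : IsTranslationSequence ϖ u) (hϖ : IsPrimeElement ϖ)
    (hχ_one : ∀ x : K, ‖x‖ ≤ 1 → χ x = 1) {b : K} (hb : ‖b‖ ≤ 1) (x : K) :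
    ballChar χ b 0 ‖(ϖ : K)‖⁻¹ x =
      ∑ m ∈ range (residueCard K), χ (b * u m) * (closedBall (u m) 1).indicator (1 : K → ℂ) x := by
  by_cases hx : ‖x‖ ≤ ‖(ϖ : K)‖⁻¹
  · obtain ⟨m, ⟨hm, hm'⟩, huniq⟩ := hu.complete x hx
    rw [sum_eq_single_of_mem m (mem_range.2 hm), ballChar,
      Set.indicator_of_mem (by simpa using hx), Set.indicator_of_mem (by simpa [dist_eq_norm]),
      Pi.one_apply, mul_one]
    · congr 1
      rw [← sub_add_cancel (b * x) (b * u m), AddChar.map_add_eq_mul, ← mul_sub, hχ_one, one_mul]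
      rw [norm_mul]
      exact mul_le_one₀ hb (norm_nonneg _) hm'
    · intro n hn hnm
      rw [Set.indicator_of_notMem, mul_zero]
      rw [mem_closedBall, dist_eq_norm]
      exact fun h => hnm (huniq n ⟨mem_range.1 hn, h⟩)
  · rw [ballChar, Set.indicator_of_notMem (by simpa using hx)]
    refine (sum_eq_zero fun m hm => ?_).symm
    rw [Set.indicator_of_notMem, mul_zero]
    rw [mem_closedBall, dist_eq_norm]
    exact fun h => hx (hu.norm_le_inv (mem_range.1 hm) hϖ h)

omit [IsUltrametricDist K] in
theorem ballChar_sub (b s x : K) :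
    ballChar χ b 0 1 (x - s) = ballChar χ (ϖ * b) 0 ‖(ϖ : K)‖⁻¹ ((ϖ : K)⁻¹ * (x - s)) := by
  have h1 : x - s ∈ closedBall (0 : K) 1 ↔
      (ϖ : K)⁻¹ * (x - s) ∈ closedBall (0 : K) ‖(ϖ : K)‖⁻¹ := by
    rw [mem_closedBall_zero_iff, mem_closedBall_zero_iff, norm_mul, norm_inv,
      mul_le_iff_le_one_right (inv_pos.2 (norm_pos_iff.2 ϖ.ne_zero))]
  by_cases h : x - s ∈ closedBall (0 : K) 1
  · rw [ballChar, ballChar, Set.indicator_of_mem h, Set.indicator_of_mem (h1.1 h)]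
    congr 2
    field_simp
  · rw [ballChar, ballChar, Set.indicator_of_notMem h, Set.indicator_of_notMem (mt h1.2 h)]

variable [MeasurableSpace K] [BorelSpace K] {μ : Measure K} [μ.IsAddHaarMeasure]

omit [IsUltrametricDist K] [BorelSpace K] in
theorem measureReal_closedBall_one (hμ : μ {x : K | ‖x‖ ≤ 1} = 1) (s : K) :
    μ.real (closedBall s 1) = 1 := by
  have h : {x : K | ‖x‖ ≤ 1} = closedBall 0 1 := by ext; simp
  rw [h] at hμ
  rw [Measure.real, ← add_zero s, ← vadd_eq_add, ← vadd_closedBall, measure_vadd, hμ]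
  rfl

/-- For `b ∈ 𝒪` the character `x ↦ χ (b x)` is constant on cosets of `𝒪`, each of measure one, so
the sum is its integral over `𝔓⁻¹`. The case `b = 0` gives the measure `q` of `𝔓⁻¹`. -/
theorem sum_character (hμ : μ {x : K | ‖x‖ ≤ 1} = 1) (hu : IsTranslationSequence ϖ u)
    (hϖ : IsPrimeElement ϖ) (hχ_one : ∀ x : K, ‖x‖ ≤ 1 → χ x = 1)
    (hχ_ne : ∃ x : K, ‖x‖ ≤ ‖(ϖ : K)‖⁻¹ ∧ χ x ≠ 1) {b : K} (hb : ‖b‖ ≤ 1) :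
    ∑ m ∈ range (residueCard K), (χ (b * u m) : ℂ) =
      if ‖b * (ϖ : K)⁻¹‖ ≤ 1 then (μ.real (closedBall (0 : K) ‖(ϖ : K)‖⁻¹) : ℂ) else 0 := by
  have h1 := integral_ballChar (μ := μ) hϖ hχ_one hχ_ne ϖ⁻¹ b
  rw [Units.val_inv_eq_inv_val, norm_inv] at h1
  rw [← h1]
  have hmeas : ∀ m, MeasurableSet (closedBall (u m) (1 : ℝ)) := fun m =>
    isClosed_closedBall.measurableSet
  have hne : ∀ m, μ (closedBall (u m) 1) ≠ ⊤ := fun m h => by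
    have := measureReal_closedBall_one hμ (u m)
    rw [Measure.real, h] at this
    simp at this
  simp only [ballChar_eq_sum hu hϖ hχ_one hb]
  rw [integral_finsetSum]
  · refine sum_congr rfl fun m _ => ?_
    have h2 : ∫ x, (closedBall (u m) 1).indicator (1 : K → ℂ) x ∂μ = 1 := by
      rw [integral_indicator (hmeas m)]
      simp [measureReal_closedBall_one hμ]
    rw [integral_const_mul, h2, mul_one]
  · intro m _
    exact ((integrable_indicator_iff (hmeas m)).2 (integrableOn_const (hne m))).const_mul _

theorem measureReal_closedBall_inv (hμ : μ {x : K | ‖x‖ ≤ 1} = 1)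
    (hu : IsTranslationSequence ϖ u) (hϖ : IsPrimeElement ϖ)
    (hχ_one : ∀ x : K, ‖x‖ ≤ 1 → χ x = 1) (hχ_ne : ∃ x : K, ‖x‖ ≤ ‖(ϖ : K)‖⁻¹ ∧ χ x ≠ 1) :
    μ.real (closedBall (0 : K) ‖(ϖ : K)‖⁻¹) = residueCard K := by
  have h := sum_character hμ hu hϖ hχ_one hχ_ne (b := 0) (by simp)
  simp only [zero_mul, AddChar.map_zero_eq_one, Circle.coe_one, sum_const, card_range, norm_zero,
    zero_le_one, if_true, nsmul_eq_mul, mul_one] at h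
  exact_mod_cast h.symm

/-- The entries `q^{-1/2} χ(ϖ u(i) u(m))` of the unitary matrix of the wavelet filters. -/
noncomputable def filterCoeff (ϖ : Kˣ) (χ : AddChar K Circle) (u : ℕ → K) (i m : ℕ) : ℂ :=
  (Real.sqrt (residueCard K) : ℂ)⁻¹ * χ (ϖ * u i * u m)

omit [MeasurableSpace K] [BorelSpace K] in
theorem filterCoeff_comm (i m : ℕ) : filterCoeff ϖ χ u i m = filterCoeff ϖ χ u m i := by
  rw [filterCoeff, filterCoeff, mul_right_comm]

/-- The sum is `q⁻¹ ∑ χ(b u(m))` with `b = ϖ (u(j) - u(i))`, and `b ϖ⁻¹ ∈ 𝒪` only if `i = j`, since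
distinct `u(i)`, `u(j)` lie in distinct cosets. -/
theorem filterCoeff_row (hμ : μ {x : K | ‖x‖ ≤ 1} = 1)
    (hu : IsTranslationSequence ϖ u) (hϖ : IsPrimeElement ϖ)
    (hχ_one : ∀ x : K, ‖x‖ ≤ 1 → χ x = 1) (hχ_ne : ∃ x : K, ‖x‖ ≤ ‖(ϖ : K)‖⁻¹ ∧ χ x ≠ 1)
    {i j : ℕ} (hi : i < residueCard K) (hj : j < residueCard K) :
    ∑ m ∈ range (residueCard K), conj (filterCoeff ϖ χ u i m) * filterCoeff ϖ χ u j m =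
      if i = j then 1 else 0 := by
  have hq : (0 : ℝ) < residueCard K := Nat.cast_pos.2 hu.residueCard_pos
  have hb : ‖(ϖ : K) * u j - ϖ * u i‖ ≤ 1 := by
    rw [sub_eq_add_neg]
    refine (IsUltrametricDist.norm_add_le_max _ _).trans (max_le (hu.norm_mul_le hj) ?_)
    rw [norm_neg]
    exact hu.norm_mul_le hi
  have h1 : ∀ m, conj (filterCoeff ϖ χ u i m) * filterCoeff ϖ χ u j m =
      (residueCard K : ℂ)⁻¹ * χ (((ϖ : K) * u j - ϖ * u i) * u m) := by
    intro m
    have h2 : ((Real.sqrt (residueCard K) : ℂ))⁻¹ * (Real.sqrt (residueCard K) : ℂ)⁻¹ =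
        (residueCard K : ℂ)⁻¹ := by
      rw [← mul_inv, ← Complex.ofReal_mul, Real.mul_self_sqrt hq.le, Complex.ofReal_natCast]
    rw [filterCoeff, filterCoeff, map_mul, map_inv₀, Complex.conj_ofReal, ← h2,
      ← Circle.coe_inv_eq_conj, ← AddChar.map_neg_eq_inv, sub_mul, sub_eq_add_neg,
      AddChar.map_add_eq_mul, Circle.coe_mul]
    ring
  simp only [h1]
  rw [← mul_sum, sum_character hμ hu hϖ hχ_one hχ_ne hb,
    measureReal_closedBall_inv hμ hu hϖ hχ_one hχ_ne]
  have h3 : ((ϖ : K) * u j - ϖ * u i) * (ϖ : K)⁻¹ = u j - u i := by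
    field_simp
  rw [h3]
  by_cases hij : i = j
  · have : (residueCard K : ℂ) ≠ 0 := Nat.cast_ne_zero.2 hu.residueCard_pos.ne'
    simp [hij, this]
  · rw [if_neg hij, if_neg, mul_zero]
    exact fun h => hij (hu.eq_of_norm_sub_le hϖ i (u j) j h (by simp))

variable [LocallyCompactSpace K]

omit [IsUltrametricDist K] [BorelSpace K] in
theorem measure_closedBall_ne_top (s : K) (r : ℝ) : μ (closedBall s r) ≠ ⊤ :=
  have : ProperSpace K := ProperSpace.of_locallyCompactSpace K
  (isCompact_closedBall s r).measure_lt_top.ne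

theorem norm_dilation_one (hμ : μ {x : K | ‖x‖ ≤ 1} = 1)
    (hu : IsTranslationSequence ϖ u) (hϖ : IsPrimeElement ϖ)
    (hχ_one : ∀ x : K, ‖x‖ ≤ 1 → χ x = 1) (hχ_ne : ∃ x : K, ‖x‖ ≤ ‖(ϖ : K)‖⁻¹ ∧ χ x ≠ 1)
    (f : Lp ℂ 2 μ) : ‖dilation μ ϖ 1 f‖ = ‖f‖ := by
  have hq : (0 : ℝ) < residueCard K := Nat.cast_pos.2 hu.residueCard_pos
  obtain ⟨c, hc⟩ := exists_map_mul μ (ϖ ^ (-1 : ℤ))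
  have hmeas : Measurable fun x : K => ((ϖ ^ (-1 : ℤ) : Kˣ) : K) * x :=
    (continuous_const.mul continuous_id).measurable
  -- The scaling constant of Haar measure is found by evaluating on `𝔓⁻¹`, of measure `q`, whose
  -- preimage is `𝒪`.
  have hcq : (c : ℝ) * residueCard K = 1 := by
    have h1 := congrArg (fun ν : Measure K => ν.real (closedBall 0 ‖(ϖ : K)‖⁻¹)) hc
    have h2 : (fun x : K => ((ϖ ^ (-1 : ℤ) : Kˣ) : K) * x) ⁻¹' closedBall 0 ‖(ϖ : K)‖⁻¹ =
        closedBall 0 1 := by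
      ext x
      rw [Set.mem_preimage, mem_closedBall_zero_iff, mem_closedBall_zero_iff, norm_mul]
      simp only [zpow_neg, zpow_one, Units.val_inv_eq_inv_val, norm_inv]
      rw [mul_le_iff_le_one_right (inv_pos.2 (norm_pos_iff.2 ϖ.ne_zero))]
    simp only [measureReal_nnreal_smul_apply,
      measureReal_closedBall_inv hμ hu hϖ hχ_one hχ_ne] at h1
    rw [← h1, map_measureReal_apply hmeas isClosed_closedBall.measurableSet, h2,
      measureReal_closedBall_one hμ]
  have h3 : eLpNorm (fun x => f (((ϖ ^ (-1 : ℤ) : Kˣ) : K) * x)) 2 μ =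
      (c : ENNReal) ^ (1 / 2 : ℝ) * eLpNorm f 2 μ := by
    have h4 := eLpNorm_map_measure (p := 2) (μ := μ) (g := f)
      (f := fun x : K => ((ϖ ^ (-1 : ℤ) : Kˣ) : K) * x)
      ((Lp.aestronglyMeasurable f).mono_ac (quasiMeasurePreserving_mul μ _).absolutelyContinuous)
      hmeas.aemeasurable
    rw [hc] at h4
    have h5 := eLpNorm_smul_measure_of_ne_top (p := 2) ENNReal.ofNat_ne_top (f : K → ℂ) (μ := μ)
      (c : ENNReal)
    rw [smul_eq_mul] at h5
    refine h4.symm.trans (h5.trans ?_)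
    norm_num
  rw [Lp.norm_def, Lp.norm_def, eLpNorm_congr_ae (dilation_ae_eq .rfl 1)]
  have h6 := eLpNorm_const_smul (((residueCard K : ℝ) ^ (((1 : ℤ) : ℝ) / 2) : ℝ) : ℂ)
    (fun x => f (((ϖ ^ (-1 : ℤ) : Kˣ) : K) * x)) 2 μ
  have h7 : (((residueCard K : ℝ) ^ (((1 : ℤ) : ℝ) / 2) : ℝ) : ℂ) •
      (fun x => f (((ϖ ^ (-1 : ℤ) : Kˣ) : K) * x)) = fun x =>
      (((residueCard K : ℝ) ^ (((1 : ℤ) : ℝ) / 2) : ℝ) : ℂ) *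
        f (((ϖ ^ (-1 : ℤ) : Kˣ) : K) * x) := rfl
  rw [h7] at h6
  rw [h6, h3, ← mul_assoc, ENNReal.toReal_mul, ENNReal.toReal_mul, ← ENNReal.toReal_rpow,
    ENNReal.coe_toReal, toReal_enorm, Complex.norm_real,
    Real.norm_of_nonneg (Real.rpow_nonneg hq.le _), Int.cast_one,
    ← Real.mul_rpow hq.le c.coe_nonneg, mul_comm _ (c : ℝ), hcq, Real.one_rpow, one_mul]

/-- The dilation `D` as a unitary operator. -/
noncomputable def dilationEquiv (μ : Measure K) [μ.IsAddHaarMeasure] (ϖ : Kˣ)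
    (hq : 0 < residueCard K) (hD : ∀ f : Lp ℂ 2 μ, ‖dilation μ ϖ 1 f‖ = ‖f‖) :
    Lp ℂ 2 μ ≃ₗᵢ[ℂ] Lp ℂ 2 μ where
  toLinearEquiv := LinearEquiv.ofLinearMap (dilation μ ϖ 1) (dilation μ ϖ (-1))
    (LinearMap.ext fun f => by
      change dilation μ ϖ 1 (dilation μ ϖ (-1) f) = f
      rw [← dilation_add hq, add_neg_cancel, dilation_zero])
    (LinearMap.ext fun f => by
      change dilation μ ϖ (-1) (dilation μ ϖ 1 f) = f
      rw [← dilation_add hq, neg_add_cancel, dilation_zero])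
  norm_map' := hD

theorem dilationEquiv_zpow {hq : 0 < residueCard K}
    {hD : ∀ f : Lp ℂ 2 μ, ‖dilation μ ϖ 1 f‖ = ‖f‖} (j : ℤ) (f : Lp ℂ 2 μ) :
    (dilationEquiv μ ϖ hq hD ^ j) f = dilation μ ϖ j f := by
  induction j using Int.induction_on generalizing f with
  | zero => rw [dilation_zero]; rfl
  | succ j ih =>
    rw [zpow_add_apply, ih, dilation_add hq, zpow_one]
    rfl
  | pred j ih =>
    rw [sub_eq_add_neg, zpow_add_apply, ih, dilation_add hq, zpow_neg_one]
    rfl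

/-- The function `x ↦ χ (b x)` on the ring of integers, extended by zero, in `L²(K)`. -/
noncomputable def wavelet (μ : Measure K) [μ.IsAddHaarMeasure] (hχ : Continuous χ) (b : K) :
    Lp ℂ 2 μ :=
  (memLp_ballChar hχ b 0 1 2).toLp (ballChar χ b 0 1)

/-- The indicator function of a ball in `L²(K)`. -/
noncomputable def ballIndicator (μ : Measure K) [μ.IsAddHaarMeasure] (s : K) (r : ℝ) :
    Lp ℂ 2 μ :=
  indicatorConstLp 2 isClosed_closedBall.measurableSet (measure_closedBall_ne_top s r) 1

omit [IsUltrametricDist K] in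
theorem wavelet_zero_ae_eq (hχ : Continuous χ) :
    wavelet μ hχ 0 =ᵐ[μ] (closedBall 0 1).indicator 1 :=
  (MemLp.coeFn_toLp _).trans (ae_of_all _ fun x => by rw [ballChar_zero]; rfl)

omit [IsUltrametricDist K] in
theorem translation_wavelet_zero (hχ : Continuous χ) (s : K) :
    translation μ s (wavelet μ hχ 0) = ballIndicator μ s 1 := by
  classical
  refine Lp.ext ((translation_ae_eq (wavelet_zero_ae_eq hχ) s).trans
    (EventuallyEq.trans (ae_of_all _ fun x => ?_) indicatorConstLp_coeFn.symm))
  simp only [Set.indicator_apply, mem_closedBall, dist_eq_norm, sub_zero, Pi.one_apply]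

theorem dilation_translation_wavelet_zero (hχ : Continuous χ) (s : K) (j : ℤ) :
    dilation μ ϖ j (translation μ s (wavelet μ hχ 0)) =
      (((residueCard K : ℝ) ^ ((j : ℝ) / 2) : ℝ) : ℂ) •
        ballIndicator μ (((ϖ ^ j : Kˣ) : K) * s) (‖(ϖ : K)‖ ^ j) := by
  classical
  refine Lp.ext ((dilation_ae_eq (translation_ae_eq (wavelet_zero_ae_eq hχ) s) j).trans
    (EventuallyEq.trans (ae_of_all _ fun x => ?_)
      ((Lp.coeFn_smul _ _).trans (indicatorConstLp_coeFn.const_smul _)).symm))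
  simp only [Set.indicator_apply, Pi.smul_apply, smul_eq_mul, Pi.one_apply]
  congr 1
  refine if_congr ?_ rfl rfl
  have h1 : x - ((ϖ ^ j : Kˣ) : K) * s = ((ϖ ^ j : Kˣ) : K) * (((ϖ ^ (-j) : Kˣ) : K) * x - s) := by
    rw [mul_sub, ← mul_assoc, ← Units.val_mul, ← zpow_add, add_neg_cancel, zpow_zero,
      Units.val_one, one_mul]
  rw [mem_closedBall_zero_iff, mem_closedBall, dist_eq_norm, h1, norm_mul,
    Units.val_zpow_eq_zpow_val ϖ j, norm_zpow, mul_le_iff_le_one_right (zpow_pos (norm_pos_iff.2 ϖ.ne_zero) j)]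

theorem orthonormal_translates (hμ : μ {x : K | ‖x‖ ≤ 1} = 1) (hu : IsTranslationSequence ϖ u)
    (hϖ : IsPrimeElement ϖ) (hχ : Continuous χ) :
    Orthonormal ℂ fun n => translation μ (u n) (wavelet μ hχ 0) := by
  classical
  rw [orthonormal_iff_ite]
  intro n m
  simp only [translation_wavelet_zero]
  rw [ballIndicator, ballIndicator, L2.inner_indicatorConstLp_one_indicatorConstLp_one
    isClosed_closedBall.measurableSet isClosed_closedBall.measurableSet
    (measure_closedBall_ne_top _ _) (measure_closedBall_ne_top _ _)]
  split_ifs with h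
  · rw [h, Set.inter_self, measureReal_closedBall_one hμ]
    simp
  · have : closedBall (u n) 1 ∩ closedBall (u m) 1 = ∅ := by
      refine Set.eq_empty_of_forall_notMem fun x hx => h ?_
      rw [Set.mem_inter_iff, mem_closedBall, mem_closedBall, dist_eq_norm, dist_eq_norm] at hx
      exact hu.eq_of_norm_sub_le hϖ n x m hx.1 hx.2
    rw [this]
    simp

/-- Every ball of radius `‖ϖ‖ ^ j` supports some `D^j T_n φ`, a nonzero multiple of its indicator,
so the hypothesis kills all integrals of `f` over balls. -/
theorem eq_zero_of_inner_dilation_eq_zero (hu : IsTranslationSequence ϖ u)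
    (hϖ : IsPrimeElement ϖ) (hχ : Continuous χ) {f : Lp ℂ 2 μ}
    (hf : ∀ (j : ℤ) (n : ℕ),
      inner ℂ (dilation μ ϖ j (translation μ (u n) (wavelet μ hχ 0))) f = 0) : f = 0 := by
  have hq : (0 : ℝ) < residueCard K := Nat.cast_pos.2 hu.residueCard_pos
  have h0 : f =ᵐ[μ] (0 : K → ℂ) := by
    refine ae_eq_zero_of_forall_closedBall hϖ.1
      ((Lp.memLp f).locallyIntegrable (by norm_num)) fun s j => ?_
    obtain ⟨n, hn⟩ := hu.exists_norm_sub_le hϖ (((ϖ ^ (-j) : Kˣ) : K) * s)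
    have h1 : closedBall s (‖(ϖ : K)‖ ^ j) =
        closedBall (((ϖ ^ j : Kˣ) : K) * u n) (‖(ϖ : K)‖ ^ j) := by
      refine closedBall_eq_of_norm_sub_le ?_
      have h2 : s - ((ϖ ^ j : Kˣ) : K) * u n =
          ((ϖ ^ j : Kˣ) : K) * (((ϖ ^ (-j) : Kˣ) : K) * s - u n) := by
        rw [mul_sub, ← mul_assoc, ← Units.val_mul, ← zpow_add, add_neg_cancel, zpow_zero,
          Units.val_one, one_mul]
      rw [h2, norm_mul, Units.val_zpow_eq_zpow_val, norm_zpow]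
      exact mul_le_of_le_one_right (zpow_nonneg (norm_nonneg _) _) hn
    have h3 := hf j n
    rw [dilation_translation_wavelet_zero, inner_smul_left, ballIndicator,
      L2.inner_indicatorConstLp_one] at h3
    rw [h1]
    refine (mul_eq_zero.1 h3).resolve_left ?_
    rw [Complex.conj_ofReal]
    refine Complex.ofReal_ne_zero.2 ?_
    exact (Real.rpow_pos_of_pos hq _).ne'
  exact Lp.ext (h0.trans (Lp.coeFn_zero ℂ 2 μ).symm)

/-- In the variable `y = ϖ⁻¹(x - u(k))` the left side is `χ(ϖ u(i) y)` on `𝔓⁻¹`. As `ϖ u(i) ∈ 𝒪`,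
this is constant on each coset `u(m) + 𝒪`, and the digit rule for `u(m + qk)` identifies the pieces.
-/
theorem translation_wavelet_eq_sum (hu : IsTranslationSequence ϖ u) (hϖ : IsPrimeElement ϖ)
    (hχ : Continuous χ) (hχ_one : ∀ x : K, ‖x‖ ≤ 1 → χ x = 1) {i : ℕ} (hi : i < residueCard K)
    (k : ℕ) :
    translation μ (u k) (wavelet μ hχ (u i)) = ∑ m ∈ range (residueCard K),
      filterCoeff ϖ χ u i m •
        dilation μ ϖ 1 (translation μ (u (m + residueCard K * k)) (wavelet μ hχ 0)) := by
  classical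
  have hq : (0 : ℝ) < residueCard K := Nat.cast_pos.2 hu.residueCard_pos
  have h1 : ∀ m, ∀ᵐ x ∂μ, m ∈ range (residueCard K) → (filterCoeff ϖ χ u i m •
      dilation μ ϖ 1 (translation μ (u (m + residueCard K * k)) (wavelet μ hχ 0)) : Lp ℂ 2 μ) x =
      χ (ϖ * u i * u m) * (closedBall (u m) 1).indicator 1 ((ϖ : K)⁻¹ * (x - u k)) := by
    intro m
    filter_upwards [Lp.coeFn_smul (filterCoeff ϖ χ u i m)
      (dilation μ ϖ 1 (translation μ (u (m + residueCard K * k)) (wavelet μ hχ 0))),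
      dilation_ae_eq (ϖ := ϖ) (translation_ae_eq (wavelet_zero_ae_eq (μ := μ) hχ)
        (u (m + residueCard K * k))) 1] with x hx1 hx2 hm
    rw [hx1, Pi.smul_apply, hx2, smul_eq_mul, filterCoeff, Int.cast_one, ← Real.sqrt_eq_rpow,
      hu.apply_add_mul hϖ (mem_range.1 hm)]
    have h2 : (Real.sqrt (residueCard K) : ℂ) ≠ 0 :=
      Complex.ofReal_ne_zero.2 (Real.sqrt_pos.2 hq).ne'
    have h3 : (closedBall (0 : K) 1).indicator (1 : K → ℂ) (((ϖ ^ (-1 : ℤ) : Kˣ) : K) * x -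
        (u m + (ϖ : K)⁻¹ * u k)) =
        (closedBall (u m) 1).indicator 1 ((ϖ : K)⁻¹ * (x - u k)) := by
      simp only [Set.indicator_apply, mem_closedBall, dist_eq_norm, Pi.one_apply, zpow_neg,
        zpow_one, Units.val_inv_eq_inv_val]
      refine if_congr ?_ rfl rfl
      rw [mul_sub, sub_zero, sub_add_eq_sub_sub_swap]
    rw [h3]
    field_simp
  refine Lp.ext ((translation_ae_eq (MemLp.coeFn_toLp _) (u k)).trans
    (EventuallyEq.trans ?_ (Lp.coeFn_fun_finsetSum _ _).symm))
  filter_upwards [ae_all_iff.2 h1] with x hx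
  rw [sum_congr rfl fun m hm => hx m hm, ← ballChar_eq_sum hu hϖ hχ_one (hu.norm_mul_le hi),
    ballChar_sub (ϖ := ϖ)]

theorem isFilterBank_wavelet (hμ : μ {x : K | ‖x‖ ≤ 1} = 1) (hu : IsTranslationSequence ϖ u)
    (hϖ : IsPrimeElement ϖ) (hχ : Continuous χ) (hχ_one : ∀ x : K, ‖x‖ ≤ 1 → χ x = 1)
    (hχ_ne : ∃ x : K, ‖x‖ ≤ ‖(ϖ : K)‖⁻¹ ∧ χ x ≠ 1) :
    IsFilterBank (dilationEquiv μ ϖ hu.residueCard_pos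
        (norm_dilation_one hμ hu hϖ hχ_one hχ_ne)) (residueCard K)
      (fun n => translation μ (u n) (wavelet μ hχ 0))
      (fun i k => translation μ (u k) (wavelet μ hχ (u i))) (filterCoeff ϖ χ u) where
  pos := hu.residueCard_pos
  orthonormal := orthonormal_translates hμ hu hϖ hχ
  zero k := by simp only [hu.zero]
  expansion i hi k := translation_wavelet_eq_sum hu hϖ hχ hχ_one hi k
  row i hi j hj := filterCoeff_row hμ hu hϖ hχ_one hχ_ne hi hj
  -- The matrix is symmetric, so column orthogonality is row orthogonality.
  col m hm n hn := by
    simp only [filterCoeff_comm _ m, filterCoeff_comm _ n]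
    exact filterCoeff_row hμ hu hϖ hχ_one hχ_ne hm hn
  exists_norm_le := by
    refine ⟨(Real.sqrt (residueCard K))⁻¹, by positivity, ?_, fun m _ => ?_⟩
    · refine inv_lt_one_of_one_lt₀ ?_
      rw [Real.lt_sqrt zero_le_one, one_pow]
      exact_mod_cast hu.one_lt_residueCard hϖ
    · rw [filterCoeff, norm_mul, Circle.norm_coe, mul_one, norm_inv, Complex.norm_real,
        Real.norm_of_nonneg (Real.sqrt_nonneg _)]

/-- Translations permute the cosets of `𝒪`, whose indicators span the space. Allowing every `a`, not
only the `u(k)`, makes the inverse translation by `-a` available for the reverse inclusion. -/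
theorem map_translation_closure_span (hu : IsTranslationSequence ϖ u)
    (hϖ : IsPrimeElement ϖ) (hχ : Continuous χ) (a : K) :
    (Submodule.span ℂ (Set.range fun n =>
      translation μ (u n) (wavelet μ hχ 0))).topologicalClosure.map (translation μ a) =
    (Submodule.span ℂ (Set.range fun n =>
      translation μ (u n) (wavelet μ hχ 0))).topologicalClosure := by
  set V := (Submodule.span ℂ (Set.range fun n =>
      translation μ (u n) (wavelet μ hχ 0))).topologicalClosure with hV
  have hle : ∀ a : K, V ≤ V.comap (translation μ a) := by
    intro a
    have hcont : Continuous (translation μ a : Lp ℂ 2 μ → Lp ℂ 2 μ) :=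
      AddMonoidHomClass.continuous_of_bound (translation μ a) 1 fun f => by
        rw [norm_translation, one_mul]
    refine Submodule.topologicalClosure_minimal _ ?_
      ((Submodule.isClosed_topologicalClosure _).preimage hcont)
    rw [Submodule.span_le]
    rintro _ ⟨n, rfl⟩
    obtain ⟨m, hm⟩ := hu.exists_norm_sub_le hϖ (a + u n)
    change translation μ a (translation μ (u n) (wavelet μ hχ 0)) ∈ V
    have h1 : ballIndicator μ (a + u n) 1 = ballIndicator μ (u m) 1 := by
      simp only [ballIndicator, closedBall_eq_of_norm_sub_le hm]
    rw [translation_translation, translation_wavelet_zero, h1, ← translation_wavelet_zero hχ]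
    exact Submodule.le_topologicalClosure _ (Submodule.subset_span ⟨m, rfl⟩)
  refine le_antisymm (Submodule.map_le_iff_le_comap.2 (hle a)) fun x hx => ?_
  refine ⟨translation μ (-a) x, hle (-a) hx, ?_⟩
  rw [translation_translation, add_neg_cancel, translation_zero]

end Wavelet

end LocalFieldWavelet

/-! ### Assembly of the main theorem. -/

theorem mainTheorem12 {K : Type*} [NontriviallyNormedField K] [IsUltrametricDist K]
    [LocallyCompactSpace K] [MeasurableSpace K] [BorelSpace K]
    (μ : MeasureTheory.Measure K) [μ.IsAddHaarMeasure] (hμ : μ {x : K | ‖x‖ ≤ 1} = 1)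
    (ϖ : Kˣ) (hϖ : LocalFieldWavelet.IsPrimeElement ϖ)
    (χ : AddChar K Circle) (hχ : Continuous χ) (hχ_one : ∀ x : K, ‖x‖ ≤ 1 → χ x = 1)
    (hχ_ne : ∃ x : K, ‖x‖ ≤ ‖(ϖ : K)‖⁻¹ ∧ χ x ≠ 1)
    (u : ℕ → K) (hu : LocalFieldWavelet.IsTranslationSequence ϖ u) :
    (∀ i : ℕ, 1 ≤ i → i ≤ LocalFieldWavelet.residueCard K - 1 →
      ∃ ψ : MeasureTheory.Lp ℂ 2 μ, LocalFieldWavelet.HasFourierTransform μ χ ψ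
        ({ξ : K | ‖ξ - u i‖ ≤ 1}.indicator (fun _ => 1))) ∧
    (∃ φ : MeasureTheory.Lp ℂ 2 μ, LocalFieldWavelet.HasFourierTransform μ χ φ
        ({ξ : K | ‖ξ‖ ≤ 1}.indicator (fun _ => 1))) ∧
    ∀ Ψ : Fin (LocalFieldWavelet.residueCard K - 1) → MeasureTheory.Lp ℂ 2 μ,
      (∀ i, LocalFieldWavelet.HasFourierTransform μ χ (Ψ i)
        ({ξ : K | ‖ξ - u (i + 1)‖ ≤ 1}.indicator (fun _ => 1))) →
      LocalFieldWavelet.IsOrthonormalMultiwavelet ϖ u Ψ ∧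
      LocalFieldWavelet.IsMRA ϖ u (LocalFieldWavelet.negativeDilates ϖ u Ψ) ∧
      ∀ φ : MeasureTheory.Lp ℂ 2 μ, LocalFieldWavelet.HasFourierTransform μ χ φ
          ({ξ : K | ‖ξ‖ ≤ 1}.indicator (fun _ => 1)) →
        LocalFieldWavelet.IsOrthonormalScalingFunction u
          (LocalFieldWavelet.negativeDilates ϖ u Ψ) φ := by
  have hW : ∀ b : K, LocalFieldWavelet.HasFourierTransform μ χ (LocalFieldWavelet.wavelet μ hχ b)
      ({ξ : K | ‖ξ - b‖ ≤ 1}.indicator fun _ => 1) :=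
    LocalFieldWavelet.hasFourierTransform_ballChar hμ hϖ hχ hχ_one hχ_ne
  have hW0 : LocalFieldWavelet.HasFourierTransform μ χ (LocalFieldWavelet.wavelet μ hχ 0)
      ({ξ : K | ‖ξ‖ ≤ 1}.indicator fun _ => 1) := by
    simpa only [sub_zero] using hW 0
  refine ⟨fun i _ _ => ⟨_, hW (u i)⟩, ⟨_, hW0⟩, fun Ψ hΨ => ?_⟩
  -- Uniqueness of the inverse transform replaces arbitrary `Ψ` by the explicit wavelets.
  obtain rfl : Ψ = fun i : Fin (LocalFieldWavelet.residueCard K - 1) =>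
      LocalFieldWavelet.wavelet μ hχ (u (i + 1)) :=
    funext fun i => (hΨ i).unique hϖ hχ hχ_one hχ_ne (hW _)
  have h := LocalFieldWavelet.isFilterBank_wavelet hμ hu hϖ hχ hχ_one hχ_ne
  set U := LocalFieldWavelet.dilationEquiv μ ϖ hu.residueCard_pos
    (LocalFieldWavelet.norm_dilation_one hμ hu hϖ hχ_one hχ_ne)
  have hU : ∀ (j : ℤ) (f : Lp ℂ 2 μ), LocalFieldWavelet.dilation μ ϖ j f = (U ^ j) f :=
    fun j f => (LocalFieldWavelet.dilationEquiv_zpow j f).symm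
  have he : ∀ f : Lp ℂ 2 μ, (∀ (j : ℤ) (n : ℕ), inner ℂ ((U ^ j)
      (LocalFieldWavelet.translation μ (u n) (LocalFieldWavelet.wavelet μ hχ 0))) f = 0) →
      f = 0 := fun f hf =>
    LocalFieldWavelet.eq_zero_of_inner_dilation_eq_zero hu hϖ hχ fun j n => by rw [hU, hf]
  have hmap : ∀ (V : Submodule ℂ (Lp ℂ 2 μ)) (j : ℤ),
      V.map (LocalFieldWavelet.dilation μ ϖ j) = LocalFieldWavelet.dilate U V j := fun V j => by
    rw [LocalFieldWavelet.dilate]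
    exact congrArg (fun T => V.map T) (LinearMap.ext (hU j))
  have hneg : LocalFieldWavelet.negativeDilates ϖ u
      (fun i : Fin (LocalFieldWavelet.residueCard K - 1) =>
        LocalFieldWavelet.wavelet μ hχ (u (i + 1))) =
      (Submodule.span ℂ (Set.range fun n => LocalFieldWavelet.translation μ (u n)
        (LocalFieldWavelet.wavelet μ hχ 0))).topologicalClosure := by
    rw [← h.closure_negative_eq, LocalFieldWavelet.negativeDilates]
    simp only [hU]
  have hscale : LocalFieldWavelet.IsOrthonormalScalingFunction u
      (Submodule.span ℂ (Set.range fun n => LocalFieldWavelet.translation μ (u n)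
        (LocalFieldWavelet.wavelet μ hχ 0))).topologicalClosure
      (LocalFieldWavelet.wavelet μ hχ 0) := by
    refine ⟨Submodule.le_topologicalClosure _ (Submodule.subset_span ⟨0, ?_⟩), h.orthonormal, rfl⟩
    simp only [hu.zero, LocalFieldWavelet.translation_zero]
  refine ⟨⟨?_, ?_⟩, ?_, fun φ hφ => ?_⟩
  · simpa only [hU] using h.orthonormal_wavelets
  · simpa only [hU] using h.span_wavelets_eq_top he
  · rw [hneg]
    refine ⟨fun j => ?_, fun k => LocalFieldWavelet.map_translation_closure_span hu hϖ hχ (u k),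
      ?_, ?_, ?_, ⟨_, hscale⟩⟩
    · rw [hmap]
      exact LocalFieldWavelet.isClosed_dilate (Submodule.isClosed_topologicalClosure _) j
    · rw [hmap]
      exact h.scaling_le_dilate
    · simp only [hmap]
      exact h.iInter_dilate he
    · simp only [hmap]
      exact h.closure_iUnion_dilate he
  · rw [hneg, hφ.unique hϖ hχ hχ_one hχ_ne hW0]
    exact hscale
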